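/- Let $f:\mathbb{R}\to\mathbb{R}$ be of class $C^2$ (not necessarily convex), let $u_+<u_-$ and $s\in\mathbb{R}$, and suppose that $(u_-,u_+;s)$ is an admissible shock of $u_t+f(u)_x=0$. Here a triple $(u_l,u_r;s)$ with $u_l\ne u_r$ is called an admissible shock if the Rankine--Hugoniot relation $s=\frac{f(u_r)-f(u_l)}{u_r-u_l}$ and the strict Oleinik condition $$\frac{f(v)-f(u_l)}{v-u_l}>s>\frac{f(u_r)-f(v)}{u_r-v}\qquad\text{for every } v \text{ strictly between } u_l \text{ and } u_r$$ hold. Put $F(v;s)=f(v)-f(u_\pm)-s(v-u_\pm)$; since $u_+<u_-$, the Oleinik condition for $(u_-,u_+;s)$ says that $F(\cdot;s)<0$ on $(u_+,u_-)$. For $\varepsilon>0$, call a pair of functions $(u,z)$ on $\mathbb{R}$ an admissible radiative profile if $z\in C^1(\mathbb{R})$, $z(\pm\infty)=u_\pm$, the set $J$ of discontinuities of $u$ is locally finite, off $J$ the function $z$ is twice differentiable and $$F(u;s)=z',\qquad -\varepsilon z''+z=u$$ (so $z'=F(z-\varepsilon z'';s)$), and at each $\xi\in J$ the one-sided limits $u(\xi\pm0)$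 exist and $(u(\xi-0),u(\xi+0);s)$ is an admissible shock of $u_t+f(u)_x=0$. Then there is $\bar\varepsilon>0$ such that for every $0<\varepsilon<\bar\varepsilon$: 1. There is an admissible radiative profile $(u,z)$ with $u(\pm\infty)=u_\pm$ whose jump set $J$ is finite. The component $z$ is $C^1$ on $\mathbb{R}$ and $C^2$ on $\mathbb{R}\setminus J$, and $z''$ has one-sided limits $(z(\xi)-u(\xi\pm0))/\varepsilon$ at each $\xi\in J$. The jumps of $u$ are located at local minima of $F(\cdot;s)$: one can assign to each $\xi\in J$ a local minimum point $c(\xi)\in(u_+,u_-)$ of $F(\cdot;s)$ with $u(\xi+0)<c(\xi)<u(\xi-0)$, and distinct jumps get distinct points. In particular, $u$ has at most as many jumps as $F(\cdot;s)$ has local minimum points in $(u_+,u_-)$. 2. The profile is unique up to translation: for any two admissible radiative profiles $(u_1,z_1)$, $(u_2,z_2)$ there is $h\in\mathbb{R}$ such that $z_2=z_1(\cdot+h)$ on $\mathbb{R}$, the jump set of $u_2$ is the jump set of $u_1$ shifted by $-h$, and $u_2=u_1(\cdot+h)$ off the jump set of $u_2$. -/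

import Mathlib

open Set Filter Topology

namespace RadiativeShock

/-- `(ul, ur; s)` is an admissible shock of the scalar conservation law `u_t + f(u)_x = 0`:
the Rankine-Hugoniot relation and the strict Oleinik condition hold. -/
def IsAdmissibleShock (f : ℝ → ℝ) (ul ur s : ℝ) : Prop :=
  ul ≠ ur ∧
  s = (f ur - f ul) / (ur - ul) ∧
  ∀ v ∈ Ioo (min ul ur) (max ul ur),
    s < (f v - f ul) / (v - ul) ∧ (f ur - f v) / (ur - v) < s

/-- The function `F(v; s) = f(v) - f(u₀) - s (v - u₀)`. When the Rankine-Hugoniot relation holds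
for `(um, up; s)`, the choices `u₀ = up` and `u₀ = um` give the same function. -/
def F (f : ℝ → ℝ) (u₀ s v : ℝ) : ℝ := f v - f u₀ - s * (v - u₀)

/-- The set of points at which `u` is not continuous. -/
def jumpSet (u : ℝ → ℝ) : Set ℝ := {ξ | ¬ ContinuousAt u ξ}

/-- `(u, z)` is an admissible solution of the profile equations
`F(u; s) = z'`, `-ε z'' + z = u` with `z(-∞) = um`, `z(+∞) = up`.
Here `z` is `C¹`; `u` is continuous off a locally finite set, and there the equations hold
classically; at every point of that set `u` has one-sided limits that form an admissible shock
of the same speed `s`. The value of `u` at a jump is irrelevant. -/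
structure IsAdmissibleProfile (f : ℝ → ℝ) (um up s ε : ℝ) (u z : ℝ → ℝ) : Prop where
  contDiff : ContDiff ℝ 1 z
  tendsto_atBot : Tendsto z atBot (𝓝 um)
  tendsto_atTop : Tendsto z atTop (𝓝 up)
  locallyFinite : ∀ R : ℝ, (jumpSet u ∩ Icc (-R) R).Finite
  differentiableAt_deriv : ∀ ξ, ξ ∉ jumpSet u → DifferentiableAt ℝ (deriv z) ξ
  first_eq : ∀ ξ, ξ ∉ jumpSet u → F f up s (u ξ) = deriv z ξ
  second_eq : ∀ ξ, ξ ∉ jumpSet u → -ε * deriv (deriv z) ξ + z ξ = u ξ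
  jump : ∀ ξ ∈ jumpSet u, ∃ ul ur : ℝ,
    Tendsto u (𝓝[<] ξ) (𝓝 ul) ∧ Tendsto u (𝓝[>] ξ) (𝓝 ur) ∧ IsAdmissibleShock f ul ur s

end RadiativeShock

/-!
For small `ε` the profile has no jump at all, and for every `ε > 0` a profile is determined up to
translation by its limits. Write `F` for `F(·; s)`; it is negative on `(up, um)` and vanishes at
both ends.

**Existence.** Use `u` as the independent variable and look for the profile on a curve
`z = ψ(u) = u + η(u)`. The equations `z' = F(u)`, `ε z'' = z - u` become the scalar equation
`(1 + η') η = γ` with `γ = ε F F'`, which is singular where `η = 0`, that is, at the end states and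
at the critical points of `F`. If `ε` is small, `γ` has a small Lipschitz constant, and there is a
Lipschitz solution through all singular points (`exists_lipschitz_solution`). It is the limit
`h → 0` of fixed points of the contraction `η ↦ (1 - h) η(x - h η(x)) + h γ(x)`
(`exists_discrete_solution`); the limit equation follows by chaining the discrete steps
(`hasDerivAt_limit`). Since `ψ` is bi-Lipschitz, its inverse `φ` is a Lipschitz function with
`(ε F(φ)² / 2)' = z - φ(z)` (`exists_slow_manifold`), so `W = F ∘ φ` satisfies
`ε W W' = z - φ(z)`. Solving `z' = W(z)` by separation of variables (`exists_connecting_orbit`) and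
putting `u = φ(z)` gives a profile with continuous `u` and `z` of class `C²`. By the uniqueness part
every admissible profile is then continuous for these `ε`, so the jump set is empty and the
assignment of local minima to jumps is a statement about the empty set.

**Uniqueness.** Let `d = z₁ - z₂` for two profiles, so that `ε d'' = d - (u₁ - u₂)`. Where `d' > 0`,
one has `F(u₁) > F(u₂)`, and the Oleinik condition forbids `u₁ - u₂` to change from negative to
positive (`IsOneSidedProfile.uR_lt_uR`). Hence, if `d ≥ 0`, `d' > 0` and `u₁ < u₂` at some point,
these relations persist to the right and `d` is convex and increasing there, contradicting `d → 0`
(`IsOneSidedProfile.not_uR_lt`). With the symmetries of the problem this shows that `d = 0` implies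
`d' = 0`, and that `u₁ ≥ u₂` and therefore `ε d'' ≤ d` wherever `d > 0`. A Hopf-type argument then
shows that two profiles whose `z`-components meet at one point coincide
(`IsOneSidedProfile.z_eq_of_touch`). As both `z`-components take the value `(up + um) / 2`, a
translation makes them meet.
-/

namespace RadiativeShock

/-! ### Comparison for second-order differential inequalities -/

theorem le_of_right_deriv_nonneg {g g' : ℝ → ℝ} {a b : ℝ} (hab : a ≤ b)
    (hg : ContinuousOn g (Icc a b))
    (hg' : ∀ t ∈ Ico a b, HasDerivWithinAt g (g' t) (Ici t) t)
    (hnonneg : ∀ t ∈ Ico a b, 0 ≤ g' t) : g a ≤ g b :=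
  image_le_of_deriv_right_le_deriv_boundary (f := fun _ => g a) (f' := fun _ => 0) (B := g)
    (B' := g') continuousOn_const (fun _ _ => hasDerivWithinAt_const _ _ _) le_rfl hg hg'
    hnonneg (right_mem_Icc.2 hab)

/-- One-sided comparison for `d'' ≥ k² d`: nonnegative initial data stay nonnegative. The operator
factors as `(∂ - k)(∂ + k)`, so `(d' + k d) e^{-kt}` and then `d e^{kt}` are nondecreasing. -/
theorem nonneg_of_sq_mul_le_right_deriv {d v v' : ℝ → ℝ} {a b k : ℝ} (hab : a ≤ b) (hk : 0 < k)
    (hd : ∀ t, HasDerivAt d (v t) t) (hv : Continuous v)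
    (hv' : ∀ t ∈ Ico a b, HasDerivWithinAt v (v' t) (Ici t) t)
    (hle : ∀ t ∈ Ico a b, k ^ 2 * d t ≤ v' t) (hda : 0 ≤ d a) (hva : 0 ≤ v a) : 0 ≤ d b := by
  have hdc : Continuous d := continuous_iff_continuousAt.2 fun t => (hd t).continuousAt
  have hE : ∀ c t : ℝ, HasDerivAt (fun t => Real.exp (c * t)) (c * Real.exp (c * t)) t := by
    intro c t
    simpa [mul_comm] using ((hasDerivAt_id t).const_mul c).exp
  have key : ∀ x ∈ Icc a b, 0 ≤ v x + k * d x := by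
    intro x hx
    have h := le_of_right_deriv_nonneg (g := fun t => (v t + k * d t) * Real.exp (-k * t)) hx.1
      (by fun_prop)
      (fun t ht => ((hv' t ⟨ht.1, ht.2.trans_le hx.2⟩).add
        ((hd t).hasDerivWithinAt.const_mul k)).mul (hE (-k) t).hasDerivWithinAt)
      (fun t ht => by
        have h1 := hle t ⟨ht.1, ht.2.trans_le hx.2⟩
        have h2 := Real.exp_pos (-k * t)
        have : (v' t + k * v t) * Real.exp (-k * t) + (v t + k * d t) * (-k * Real.exp (-k * t))
          = (v' t - k ^ 2 * d t) * Real.exp (-k * t) := by ring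
        simp only [Pi.add_apply]
        rw [this]
        exact mul_nonneg (by linarith) h2.le)
    have h0 : 0 ≤ (v a + k * d a) * Real.exp (-k * a) := by positivity
    exact nonneg_of_mul_nonneg_left (h0.trans h) (Real.exp_pos _)
  have h := le_of_right_deriv_nonneg (g := fun t => d t * Real.exp (k * t)) hab (by fun_prop)
      (fun t _ => ((hd t).mul (hE k t)).hasDerivWithinAt)
      (fun t ht => by
        have h1 := key t ⟨ht.1, ht.2.le⟩
        have : v t * Real.exp (k * t) + d t * (k * Real.exp (k * t))
          = (v t + k * d t) * Real.exp (k * t) := by ring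
        rw [this]
        exact mul_nonneg h1 (Real.exp_pos _).le)
  have h0 : 0 ≤ d a * Real.exp (k * a) := by positivity
  exact nonneg_of_mul_nonneg_left (h0.trans h) (Real.exp_pos _)

/-! ### The touching principle for profiles -/

/-- A solution of `G(u) = z'`, `-ε z'' + z = u` whose second component is recorded through its
one-sided limits `uL`, `uR` (equal where `u` is continuous), with `w = z'`. The last two fields are
the Oleinik condition across a jump from `uL t` to `uR t`. -/
structure IsOneSidedProfile (G : ℝ → ℝ) (ε : ℝ) (z w uL uR : ℝ → ℝ) : Prop where
  hasDerivAt : ∀ t, HasDerivAt z (w t) t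
  right_deriv : ∀ t, HasDerivWithinAt w ((z t - uR t) / ε) (Ici t) t
  left_deriv : ∀ t, HasDerivWithinAt w ((z t - uL t) / ε) (Iic t) t
  uR_right : ∀ t, Tendsto uR (𝓝[>] t) (𝓝 (uR t))
  uL_right : ∀ t, Tendsto uL (𝓝[>] t) (𝓝 (uR t))
  uR_left : ∀ t, Tendsto uR (𝓝[<] t) (𝓝 (uL t))
  uL_left : ∀ t, Tendsto uL (𝓝[<] t) (𝓝 (uL t))
  left_eq : ∀ t, G (uL t) = w t
  right_eq : ∀ t, G (uR t) = w t
  lt_of_down : ∀ t, ∀ v ∈ Ioo (uR t) (uL t), G v < w t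
  lt_of_up : ∀ t, ∀ v ∈ Ioo (uL t) (uR t), w t < G v

namespace IsOneSidedProfile

variable {G : ℝ → ℝ} {ε : ℝ} {z w uL uR z₁ w₁ uL₁ uR₁ z₂ w₂ uL₂ uR₂ : ℝ → ℝ}

theorem continuous_w (h : IsOneSidedProfile G ε z w uL uR) : Continuous w :=
  continuous_iff_continuousAt.2 fun t => continuousAt_iff_continuous_left_right.2
    ⟨(h.left_deriv t).continuousWithinAt, (h.right_deriv t).continuousWithinAt⟩

/-- Reversing the direction of the line turns profiles for `G` into profiles for `-G`. -/
theorem reflect (h : IsOneSidedProfile G ε z w uL uR) :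
    IsOneSidedProfile (fun v => -G v) ε (fun t => z (-t)) (fun t => -w (-t))
      (fun t => uR (-t)) (fun t => uL (-t)) where
  hasDerivAt t := ((h.hasDerivAt (-t)).comp t (hasDerivAt_neg t)).congr_deriv (by simp)
  right_deriv t :=
    ((h.left_deriv (-t)).scomp t (hasDerivAt_neg t).hasDerivWithinAt
      (s := Ici t) (fun x hx => by simpa using hx)).neg.congr_deriv (by simp)
  left_deriv t :=
    ((h.right_deriv (-t)).scomp t (hasDerivAt_neg t).hasDerivWithinAt
      (s := Iic t) (fun x hx => by simpa using hx)).neg.congr_deriv (by simp)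
  uR_right t := (h.uL_left (-t)).comp tendsto_neg_nhdsGT
  uL_right t := (h.uR_left (-t)).comp tendsto_neg_nhdsGT
  uR_left t := (h.uL_right (-t)).comp tendsto_neg_nhdsLT
  uL_left t := (h.uR_right (-t)).comp tendsto_neg_nhdsLT
  left_eq t := by simp [h.right_eq]
  right_eq t := by simp [h.left_eq]
  lt_of_down t v hv := neg_lt_neg (h.lt_of_up (-t) v hv)
  lt_of_up t v hv := neg_lt_neg (h.lt_of_down (-t) v hv)

/-- Where `z₁' > z₂'`, the difference `u₁ - u₂` cannot change sign from nonpositive to positive: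
if it did, the intervals spanned by the jumps of `u₁` and `u₂` would overlap, and the Oleinik
conditions would put `G` both above `z₁'` and below `z₂'` there. -/
theorem uR_lt_uR (h₁ : IsOneSidedProfile G ε z₁ w₁ uL₁ uR₁)
    (h₂ : IsOneSidedProfile G ε z₂ w₂ uL₂ uR₂) {t : ℝ} (hw : w₂ t < w₁ t)
    (hL : uL₁ t ≤ uL₂ t) : uR₁ t < uR₂ t := by
  have a1 := h₁.left_eq t
  have b1 := h₁.right_eq t
  have a2 := h₂.left_eq t
  have b2 := h₂.right_eq t
  have d1 := h₁.lt_of_down t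
  have d2 := h₂.lt_of_down t
  have e1 := h₁.lt_of_up t
  have e2 := h₂.lt_of_up t
  have hne : ∀ {x y}, G x = w₁ t → G y = w₂ t → x ≠ y := by
    rintro x y hx hy rfl
    linarith
  have hab : uL₁ t < uL₂ t := lt_of_le_of_ne hL (hne a1 a2)
  by_contra hcon
  have hba : uR₂ t < uR₁ t := lt_of_le_of_ne (not_lt.1 hcon) (hne b1 b2).symm
  -- in each case some left or right state of one profile lies inside the jump of the other
  rcases le_or_gt (uR₁ t) (uL₁ t) with hdown | hup
  · exact absurd (d2 (uL₁ t) ⟨hba.trans_le hdown, hab⟩) (by linarith)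
  · rcases le_or_gt (uL₂ t) (uR₂ t) with h2 | h2
    · exact absurd (e1 (uL₂ t) ⟨hab, h2.trans_lt hba⟩) (by linarith)
    · rcases lt_trichotomy (uL₁ t) (uR₂ t) with h3 | h3 | h3
      · exact absurd (e1 (uR₂ t) ⟨h3, hba⟩) (by linarith)
      · exact hne a1 b2 h3
      · exact absurd (d2 (uL₁ t) ⟨h3, hab⟩) (by linarith)

theorem hasDerivAt_sub (h₁ : IsOneSidedProfile G ε z₁ w₁ uL₁ uR₁)
    (h₂ : IsOneSidedProfile G ε z₂ w₂ uL₂ uR₂) (t : ℝ) :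
    HasDerivAt (fun t => z₁ t - z₂ t) (w₁ t - w₂ t) t :=
  (h₁.hasDerivAt t).sub (h₂.hasDerivAt t)

theorem right_deriv_sub (h₁ : IsOneSidedProfile G ε z₁ w₁ uL₁ uR₁)
    (h₂ : IsOneSidedProfile G ε z₂ w₂ uL₂ uR₂) (t : ℝ) :
    HasDerivWithinAt (fun t => w₁ t - w₂ t) ((z₁ t - z₂ t) / ε - (uR₁ t - uR₂ t) / ε)
      (Ici t) t :=
  ((h₁.right_deriv t).sub (h₂.right_deriv t)).congr_deriv (by ring)

/-- If `z₁ - z₂` is nonnegative and increasing at `t` while `u₁ < u₂` just to the right of `t`,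
then these relations persist for all later times, and `z₁ - z₂` grows at least linearly. This is
impossible when `z₁ - z₂` tends to zero. -/
theorem not_uR_lt (hε : 0 < ε) (h₁ : IsOneSidedProfile G ε z₁ w₁ uL₁ uR₁)
    (h₂ : IsOneSidedProfile G ε z₂ w₂ uL₂ uR₂)
    (hlim : Tendsto (fun t => z₁ t - z₂ t) atTop (𝓝 0)) {t : ℝ}
    (hz : z₂ t ≤ z₁ t) (hw : w₂ t < w₁ t) : uR₂ t ≤ uR₁ t := by
  by_contra hu
  rw [not_le] at hu
  have hdc : Continuous fun t => z₁ t - z₂ t :=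
    continuous_iff_continuousAt.2 fun t => (hasDerivAt_sub h₁ h₂ t).continuousAt
  have hvc : Continuous fun t => w₁ t - w₂ t := h₁.continuous_w.sub h₂.continuous_w
  -- while `u₁ < u₂` persists, `z₁ - z₂` stays nonnegative and `w₁ - w₂` does not decrease
  have step : ∀ T, t ≤ T → (∀ τ ∈ Ico t T, uR₁ τ < uR₂ τ) →
      0 ≤ z₁ T - z₂ T ∧ w₁ t - w₂ t ≤ w₁ T - w₂ T := by
    intro T hT hlt
    have hd : ∀ S ∈ Icc t T, 0 ≤ z₁ S - z₂ S := by
      intro S hS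
      refine nonneg_of_sq_mul_le_right_deriv (d := fun t => z₁ t - z₂ t)
        (v := fun t => w₁ t - w₂ t) (k := Real.sqrt (1 / ε)) hS.1 (by positivity)
        (hasDerivAt_sub h₁ h₂) hvc (fun τ _ => right_deriv_sub h₁ h₂ τ) ?_ (by simpa using hz)
        (by simpa using hw.le)
      intro τ hτ
      rw [Real.sq_sqrt (by positivity)]
      have : (uR₁ τ - uR₂ τ) / ε ≤ 0 :=
        div_nonpos_of_nonpos_of_nonneg
          (sub_nonpos.2 (hlt τ ⟨hτ.1, hτ.2.trans_le hS.2⟩).le) hε.le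
      have e : 1 / ε * (z₁ τ - z₂ τ) = (z₁ τ - z₂ τ) / ε := by ring
      rw [e]
      linarith
    refine ⟨hd T ⟨hT, le_rfl⟩, ?_⟩
    refine le_of_right_deriv_nonneg (g := fun t => w₁ t - w₂ t) hT hvc.continuousOn
      (fun τ _ => right_deriv_sub h₁ h₂ τ) ?_
    intro τ hτ
    have h3 : (uR₁ τ - uR₂ τ) / ε ≤ 0 :=
      div_nonpos_of_nonpos_of_nonneg (sub_nonpos.2 (hlt τ hτ).le) hε.le
    have h4 : 0 ≤ (z₁ τ - z₂ τ) / ε := div_nonneg (hd τ ⟨hτ.1, hτ.2.le⟩) hε.le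
    linarith
  have hall : ∀ T, t ≤ T → uR₁ T < uR₂ T := by
    by_contra! hex
    obtain ⟨T₀, hT₀, hT₀'⟩ := hex
    set S := {T | t ≤ T ∧ uR₂ T ≤ uR₁ T} with hS
    have hbdd : BddBelow S := ⟨t, fun x hx => hx.1⟩
    have hne : S.Nonempty := ⟨T₀, hT₀, hT₀'⟩
    set m := sInf S with hm
    have htm : t ≤ m := le_csInf hne fun x hx => hx.1
    have hlt : ∀ τ ∈ Ico t m, uR₁ τ < uR₂ τ := by
      intro τ hτ
      by_contra hc
      exact absurd (csInf_le hbdd (show τ ∈ S from ⟨hτ.1, not_lt.1 hc⟩)) (not_le.2 hτ.2)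
    have hum : uR₁ m < uR₂ m := by
      rcases htm.eq_or_lt with h | h
      · rw [← h]; exact hu
      · refine uR_lt_uR h₁ h₂ (by have := (step m htm hlt).2; linarith) ?_
        refine le_of_tendsto_of_tendsto (h₁.uR_left m) (h₂.uR_left m) ?_
        filter_upwards [Ioo_mem_nhdsLT h] with τ hτ
        exact (hlt τ ⟨hτ.1.le, hτ.2⟩).le
    have hev : ∀ᶠ τ in 𝓝[>] m, uR₁ τ < uR₂ τ :=
      (h₁.uR_right m).eventually_lt (h₂.uR_right m) hum
    obtain ⟨b, hb, hbs⟩ := mem_nhdsGT_iff_exists_Ioo_subset.1 hev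
    have : b ≤ m := le_csInf hne fun x hx => by
      by_contra hxb
      have hmx : m ≤ x := csInf_le hbdd hx
      rcases hmx.eq_or_lt with h | h
      · rw [← h] at hx; exact absurd hum (not_lt.2 hx.2)
      · exact absurd (hbs ⟨h, not_le.1 hxb⟩) (not_lt.2 hx.2)
    exact absurd hb (not_lt.2 this)
  have hgrow : ∀ T, t ≤ T → (w₁ t - w₂ t) * (T - t) ≤ z₁ T - z₂ T := by
    intro T hT
    have := le_of_right_deriv_nonneg
      (g := fun τ => (z₁ τ - z₂ τ) - (w₁ t - w₂ t) * (τ - t))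
      hT (by fun_prop)
      (fun τ _ => ((hasDerivAt_sub h₁ h₂ τ).sub
        (((hasDerivAt_id τ).sub_const t).const_mul (w₁ t - w₂ t))).hasDerivWithinAt)
      (fun τ hτ => by
        have := (step τ hτ.1 fun σ hσ => hall σ hσ.1).2
        linarith)
    simp only [sub_self, mul_zero, sub_zero] at this
    linarith
  have hA : Tendsto (fun T => (w₁ t - w₂ t) * (T - t)) atTop atTop :=
    (tendsto_atTop_add_const_right _ (-t) tendsto_id).const_mul_atTop (by linarith)
  exact not_tendsto_nhds_of_tendsto_atTop
    (tendsto_atTop_mono' _ ((eventually_ge_atTop t).mono hgrow) hA) 0 hlim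

/-- The mirror image of `not_uR_lt`, looking to the left. -/
theorem uL_le_uL (hε : 0 < ε) (h₁ : IsOneSidedProfile G ε z₁ w₁ uL₁ uR₁)
    (h₂ : IsOneSidedProfile G ε z₂ w₂ uL₂ uR₂)
    (hlim : Tendsto (fun t => z₁ t - z₂ t) atBot (𝓝 0)) {t : ℝ}
    (hz : z₁ t ≤ z₂ t) (hw : w₂ t < w₁ t) : uL₁ t ≤ uL₂ t := by
  have hl : Tendsto (fun t => z₂ (-t) - z₁ (-t)) atTop (𝓝 0) := by
    have := (hlim.neg).comp tendsto_neg_atTop_atBot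
    simpa [Function.comp_def] using this
  simpa using not_uR_lt hε h₂.reflect h₁.reflect hl (t := -t) (by simpa using hz)
    (by simpa using hw)

/-- Profiles can only meet tangentially: at a transversal crossing `not_uR_lt` and `uL_le_uL` give
`u₁ - u₂` the two signs that `uR_lt_uR` excludes. -/
theorem w_eq_of_z_eq (hε : 0 < ε) (h₁ : IsOneSidedProfile G ε z₁ w₁ uL₁ uR₁)
    (h₂ : IsOneSidedProfile G ε z₂ w₂ uL₂ uR₂)
    (htop : Tendsto (fun t => z₁ t - z₂ t) atTop (𝓝 0))
    (hbot : Tendsto (fun t => z₁ t - z₂ t) atBot (𝓝 0)) {t : ℝ} (hz : z₁ t = z₂ t) :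
    w₁ t = w₂ t := by
  have swap : ∀ {l : Filter ℝ}, Tendsto (fun t => z₁ t - z₂ t) l (𝓝 0) →
      Tendsto (fun t => z₂ t - z₁ t) l (𝓝 0) := fun h => by simpa using h.neg
  rcases lt_trichotomy (w₁ t) (w₂ t) with h | h | h
  · have a := uL_le_uL hε h₂ h₁ (swap hbot) hz.ge h
    exact absurd (uR_lt_uR h₂ h₁ h a) (not_lt.2 (not_uR_lt hε h₂ h₁ (swap htop) hz.le h))
  · exact h
  · have a := uL_le_uL hε h₁ h₂ hbot hz.le h
    exact absurd (uR_lt_uR h₁ h₂ h a) (not_lt.2 (not_uR_lt hε h₁ h₂ htop hz.ge h))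

/-- If `u₁ < u₂` just to the right of a point with `z₁ > z₂`, then `z₁' < z₂'` at the point
contradicts `uL_le_uL` at nearby later points; otherwise `z₁'' > z₂''` makes `z₁' > z₂'` right after
it, which contradicts `not_uR_lt`. -/
theorem uR_le_uR_of_lt (hε : 0 < ε) (h₁ : IsOneSidedProfile G ε z₁ w₁ uL₁ uR₁)
    (h₂ : IsOneSidedProfile G ε z₂ w₂ uL₂ uR₂)
    (htop : Tendsto (fun t => z₁ t - z₂ t) atTop (𝓝 0))
    (hbot : Tendsto (fun t => z₁ t - z₂ t) atBot (𝓝 0)) {t : ℝ} (hz : z₂ t < z₁ t) :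
    uR₂ t ≤ uR₁ t := by
  by_contra hu
  rw [not_le] at hu
  have c1 : Continuous z₁ := continuous_iff_continuousAt.2 fun t => (h₁.hasDerivAt t).continuousAt
  have c2 : Continuous z₂ := continuous_iff_continuousAt.2 fun t => (h₂.hasDerivAt t).continuousAt
  have ez : ∀ᶠ τ in 𝓝[>] t, z₂ τ < z₁ τ :=
    (((c2.tendsto t).eventually_lt (c1.tendsto t) hz)).filter_mono nhdsWithin_le_nhds
  have eR : ∀ᶠ τ in 𝓝[>] t, uR₁ τ < uR₂ τ := (h₁.uR_right t).eventually_lt (h₂.uR_right t) hu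
  have eL : ∀ᶠ τ in 𝓝[>] t, uL₁ τ < uL₂ τ := (h₁.uL_right t).eventually_lt (h₂.uL_right t) hu
  rcases lt_or_ge (w₁ t) (w₂ t) with h | h
  · have ew : ∀ᶠ τ in 𝓝[>] t, w₁ τ < w₂ τ :=
      ((h₁.continuous_w.tendsto t).eventually_lt (h₂.continuous_w.tendsto t) h).filter_mono
        nhdsWithin_le_nhds
    obtain ⟨τ, hτz, hτL, hτw⟩ := (ez.and (eL.and ew)).exists
    exact absurd (uL_le_uL hε h₂ h₁ (by simpa using hbot.neg) hτz.le hτw) (not_le.2 hτL)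
  · -- here `w₁ - w₂` has a positive right derivative, so it is positive just after `t`
    have ew : ∀ᶠ τ in 𝓝[>] t, w₂ τ < w₁ τ := by
      have hder := (hasDerivWithinAt_iff_tendsto_slope' (by simp)).1
        (right_deriv_sub h₁ h₂ t).Ioi_of_Ici
      have hpos : 0 < (z₁ t - z₂ t) / ε - (uR₁ t - uR₂ t) / ε := by
        rw [← sub_div]
        exact div_pos (by linarith) hε
      filter_upwards [hder.eventually_const_lt hpos, self_mem_nhdsWithin] with τ hτ hτt
      rw [slope_def_field, div_pos_iff_of_pos_right (sub_pos.2 hτt)] at hτ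
      linarith
    obtain ⟨τ, hτz, hτR, hτw⟩ := (ez.and (eR.and ew)).exists
    exact absurd (not_uR_lt hε h₁ h₂ htop hτz.le hτw) (not_le.2 hτR)

/-- To the right of a contact point `z₁` cannot exceed `z₂`: after the last contact `d = z₁ - z₂`
would be positive with `ε d'' ≤ d`, while `d = d' = 0` at the contact, which forces `d ≤ 0`. -/
theorem z_le_z_of_le (hε : 0 < ε) (h₁ : IsOneSidedProfile G ε z₁ w₁ uL₁ uR₁)
    (h₂ : IsOneSidedProfile G ε z₂ w₂ uL₂ uR₂)
    (htop : Tendsto (fun t => z₁ t - z₂ t) atTop (𝓝 0))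
    (hbot : Tendsto (fun t => z₁ t - z₂ t) atBot (𝓝 0)) {t₀ t : ℝ} (hz : z₁ t₀ = z₂ t₀)
    (ht : t₀ ≤ t) : z₁ t ≤ z₂ t := by
  by_contra hlt
  rw [not_le] at hlt
  have hdc : Continuous fun t => z₁ t - z₂ t :=
    continuous_iff_continuousAt.2 fun t => (hasDerivAt_sub h₁ h₂ t).continuousAt
  -- `a` is the last contact before `t`
  set S := {τ | z₁ τ - z₂ τ = 0} ∩ Icc t₀ t with hS
  have hcomp : IsCompact S := isCompact_Icc.inter_left (isClosed_eq hdc continuous_const)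
  obtain ⟨a, ⟨haz, hat⟩, hmax⟩ := hcomp.exists_isGreatest ⟨t₀, sub_eq_zero.2 hz, le_rfl, ht⟩
  have haz' : z₁ a = z₂ a := sub_eq_zero.1 haz
  have hpos : ∀ τ ∈ Ioc a t, 0 < z₁ τ - z₂ τ := by
    intro τ hτ
    by_contra hc
    obtain ⟨σ, hσ, hσ0⟩ := intermediate_value_Icc hτ.2 hdc.continuousOn
      (show (0 : ℝ) ∈ Icc _ _ from ⟨not_lt.1 hc, (sub_pos.2 hlt).le⟩)
    exact absurd (hmax ⟨hσ0, hat.1.trans (hτ.1.le.trans hσ.1), hσ.2⟩)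
      (not_le.2 (hτ.1.trans_le hσ.1))
  have haw := w_eq_of_z_eq hε h₁ h₂ htop hbot haz'
  have huR : ∀ τ ∈ Ico a t, uR₂ τ ≤ uR₁ τ := by
    intro τ hτ
    rcases hτ.1.eq_or_lt with h | h
    · refine h ▸ le_of_tendsto_of_tendsto (h₂.uR_right a) (h₁.uR_right a) ?_
      filter_upwards [Ioo_mem_nhdsGT (hτ.1.trans_lt hτ.2)] with σ hσ
      exact uR_le_uR_of_lt hε h₁ h₂ htop hbot (sub_pos.1 (hpos σ ⟨hσ.1, hσ.2.le⟩))
    · exact uR_le_uR_of_lt hε h₁ h₂ htop hbot (sub_pos.1 (hpos τ ⟨h, hτ.2.le⟩))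
  have := nonneg_of_sq_mul_le_right_deriv (d := fun t => z₂ t - z₁ t)
        (v := fun t => w₂ t - w₁ t) (k := Real.sqrt (1 / ε)) hat.2 (by positivity)
        (hasDerivAt_sub h₂ h₁) (h₂.continuous_w.sub h₁.continuous_w)
        (fun τ _ => right_deriv_sub h₂ h₁ τ)
        (fun τ hτ => by
          rw [Real.sq_sqrt (by positivity)]
          have : (uR₂ τ - uR₁ τ) / ε ≤ 0 :=
            div_nonpos_of_nonpos_of_nonneg (sub_nonpos.2 (huR τ hτ)) hε.le
          have e : 1 / ε * (z₂ τ - z₁ τ) = (z₂ τ - z₁ τ) / ε := by ring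
          rw [e]
          linarith) (by simp [haz']) (by simp [haw])
  simp only [sub_nonneg] at this
  linarith

/-- Touching principle: two profiles with the same limits at `±∞` that meet at one point
coincide. -/
theorem z_eq_of_touch (hε : 0 < ε) (h₁ : IsOneSidedProfile G ε z₁ w₁ uL₁ uR₁)
    (h₂ : IsOneSidedProfile G ε z₂ w₂ uL₂ uR₂)
    (htop : Tendsto (fun t => z₁ t - z₂ t) atTop (𝓝 0))
    (hbot : Tendsto (fun t => z₁ t - z₂ t) atBot (𝓝 0)) {t₀ : ℝ} (hz : z₁ t₀ = z₂ t₀) (t : ℝ) :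
    z₁ t = z₂ t := by
  have hright : ∀ {G : ℝ → ℝ} {z₁ w₁ uL₁ uR₁ z₂ w₂ uL₂ uR₂ : ℝ → ℝ}
      (_ : IsOneSidedProfile G ε z₁ w₁ uL₁ uR₁) (_ : IsOneSidedProfile G ε z₂ w₂ uL₂ uR₂)
      (_ : Tendsto (fun t => z₁ t - z₂ t) atTop (𝓝 0))
      (_ : Tendsto (fun t => z₁ t - z₂ t) atBot (𝓝 0)) {t₀ t : ℝ}
      (_ : z₁ t₀ = z₂ t₀) (_ : t₀ ≤ t), z₁ t = z₂ t := by
    intro G z₁ w₁ uL₁ uR₁ z₂ w₂ uL₂ uR₂ h₁ h₂ htop hbot t₀ t hz ht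
    exact le_antisymm (z_le_z_of_le hε h₁ h₂ htop hbot hz ht)
      (z_le_z_of_le hε h₂ h₁ (by simpa using htop.neg) (by simpa using hbot.neg) hz.symm ht)
  rcases le_total t₀ t with h | h
  · exact hright h₁ h₂ htop hbot hz h
  · have := hright h₁.reflect h₂.reflect (hbot.comp tendsto_neg_atTop_atBot)
      (htop.comp tendsto_neg_atBot_atTop) (t₀ := -t₀) (t := -t) (by simpa using hz)
      (neg_le_neg h)
    simpa using this

end IsOneSidedProfile

/-! ### Uniqueness up to translation -/

theorem contDiff_F {f : ℝ → ℝ} {n : WithTop ℕ∞} (hf : ContDiff ℝ n f) (u₀ s : ℝ) :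
    ContDiff ℝ n (F f u₀ s) := by
  unfold F
  fun_prop

theorem IsAdmissibleShock.F_eq {f : ℝ → ℝ} {ul ur s : ℝ} (h : IsAdmissibleShock f ul ur s)
    (u₀ : ℝ) : F f u₀ s ul = F f u₀ s ur := by
  have h1 := h.2.1
  rw [eq_div_iff (sub_ne_zero.2 h.1.symm)] at h1
  unfold F
  linarith

theorem IsAdmissibleShock.F_lt {f : ℝ → ℝ} {ul ur s v : ℝ} (h : IsAdmissibleShock f ul ur s)
    (u₀ : ℝ) (hv : v ∈ Ioo ur ul) : F f u₀ s v < F f u₀ s ul := by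
  have hlt := hv.1.trans hv.2
  have h1 := (h.2.2 v (by rwa [min_eq_right hlt.le, max_eq_left hlt.le])).1
  rw [lt_div_iff_of_neg (sub_neg.2 hv.2)] at h1
  unfold F
  linarith

theorem IsAdmissibleShock.lt_F {f : ℝ → ℝ} {ul ur s v : ℝ} (h : IsAdmissibleShock f ul ur s)
    (u₀ : ℝ) (hv : v ∈ Ioo ul ur) : F f u₀ s ul < F f u₀ s v := by
  have hlt := hv.1.trans hv.2
  have h1 := (h.2.2 v (by rwa [min_eq_left hlt.le, max_eq_right hlt.le])).1
  rw [lt_div_iff₀ (sub_pos.2 hv.1)] at h1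
  unfold F
  linarith

namespace IsAdmissibleProfile

variable {f : ℝ → ℝ} {um up s ε : ℝ} {u z : ℝ → ℝ}

theorem eventually_notMem_jumpSet (h : IsAdmissibleProfile f um up s ε u z) (ξ : ℝ) :
    ∀ᶠ τ in 𝓝[≠] ξ, τ ∉ jumpSet u := by
  have hfin := (h.locallyFinite (|ξ| + 1)).subset (sdiff_subset (t := {ξ}))
  have h1 : ∀ᶠ τ in 𝓝 ξ, τ ∉ (jumpSet u ∩ Icc (-(|ξ| + 1)) (|ξ| + 1)) \ {ξ} :=
    hfin.isClosed.isOpen_compl.mem_nhds (by simp)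
  have h2 : ∀ᶠ τ in 𝓝 ξ, τ ∈ Icc (-(|ξ| + 1)) (|ξ| + 1) :=
    Icc_mem_nhds (by linarith [neg_abs_le ξ]) (by linarith [le_abs_self ξ])
  filter_upwards [h1.filter_mono nhdsWithin_le_nhds, h2.filter_mono nhdsWithin_le_nhds,
    self_mem_nhdsWithin] with τ hτ hτ2 hne hJ
  exact hτ ⟨⟨hJ, hτ2⟩, hne⟩

theorem leftLim_eq_of_notMem {ξ : ℝ} (hξ : ξ ∉ jumpSet u) : Function.leftLim u ξ = u ξ :=
  leftLim_eq_of_tendsto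
    ((not_not.1 hξ : ContinuousAt u ξ).tendsto.mono_left nhdsWithin_le_nhds)

theorem rightLim_eq_of_notMem {ξ : ℝ} (hξ : ξ ∉ jumpSet u) : Function.rightLim u ξ = u ξ :=
  rightLim_eq_of_tendsto
    ((not_not.1 hξ : ContinuousAt u ξ).tendsto.mono_left nhdsWithin_le_nhds)

theorem isAdmissibleShock_of_mem (h : IsAdmissibleProfile f um up s ε u z) {ξ : ℝ}
    (hξ : ξ ∈ jumpSet u) :
    IsAdmissibleShock f (Function.leftLim u ξ) (Function.rightLim u ξ) s := by
  obtain ⟨ul, ur, hl, hr, hs⟩ := h.jump ξ hξ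
  rwa [leftLim_eq_of_tendsto hl, rightLim_eq_of_tendsto hr]

theorem mem_jumpSet_iff (h : IsAdmissibleProfile f um up s ε u z) {ξ : ℝ} :
    ξ ∈ jumpSet u ↔ Function.leftLim u ξ ≠ Function.rightLim u ξ := by
  refine ⟨fun hξ => (h.isAdmissibleShock_of_mem hξ).1, fun hne => ?_⟩
  by_contra hξ
  exact hne ((leftLim_eq_of_notMem hξ).trans (rightLim_eq_of_notMem hξ).symm)

theorem tendsto_leftLim (h : IsAdmissibleProfile f um up s ε u z) (ξ : ℝ) :
    Tendsto u (𝓝[<] ξ) (𝓝 (Function.leftLim u ξ)) := by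
  by_cases hξ : ξ ∈ jumpSet u
  · obtain ⟨ul, ur, hl, -, -⟩ := h.jump ξ hξ
    rwa [leftLim_eq_of_tendsto hl]
  · rw [leftLim_eq_of_notMem hξ]
    exact (not_not.1 hξ : ContinuousAt u ξ).tendsto.mono_left nhdsWithin_le_nhds

theorem tendsto_rightLim (h : IsAdmissibleProfile f um up s ε u z) (ξ : ℝ) :
    Tendsto u (𝓝[>] ξ) (𝓝 (Function.rightLim u ξ)) := by
  by_cases hξ : ξ ∈ jumpSet u
  · obtain ⟨ul, ur, -, hr, -⟩ := h.jump ξ hξ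
    rwa [rightLim_eq_of_tendsto hr]
  · rw [rightLim_eq_of_notMem hξ]
    exact (not_not.1 hξ : ContinuousAt u ξ).tendsto.mono_left nhdsWithin_le_nhds

/-- Passing to one-sided limits of `u` removes the exceptional set from the equations. -/
theorem isOneSidedProfile (hf : ContDiff ℝ 2 f) (hε : 0 < ε)
    (h : IsAdmissibleProfile f um up s ε u z) :
    IsOneSidedProfile (F f up s) ε z (deriv z) (Function.leftLim u) (Function.rightLim u) := by
  have hzd : Differentiable ℝ z := h.contDiff.differentiable one_ne_zero
  have hw : Continuous (deriv z) := h.contDiff.continuous_deriv le_rfl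
  have hF : Continuous (F f up s) := (contDiff_F hf up s).continuous
  have hlt : ∀ ξ : ℝ, 𝓝[<] ξ ≤ 𝓝[≠] ξ := fun ξ => nhdsWithin_mono _ fun x hx => hx.ne
  have hgt : ∀ ξ : ℝ, 𝓝[>] ξ ≤ 𝓝[≠] ξ := fun ξ => nhdsWithin_mono _ fun x hx => hx.ne'
  have hdd : ∀ τ, τ ∉ jumpSet u → deriv (deriv z) τ = (z τ - u τ) / ε := by
    intro τ hτ
    rw [eq_div_iff hε.ne']
    linarith [h.second_eq τ hτ]
  have evL : ∀ ξ, ∀ᶠ τ in 𝓝[≠] ξ, Function.leftLim u τ = u τ := fun ξ =>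
    (h.eventually_notMem_jumpSet ξ).mono fun τ hτ => leftLim_eq_of_notMem hτ
  have evR : ∀ ξ, ∀ᶠ τ in 𝓝[≠] ξ, Function.rightLim u τ = u τ := fun ξ =>
    (h.eventually_notMem_jumpSet ξ).mono fun τ hτ => rightLim_eq_of_notMem hτ
  have hL : ∀ t, F f up s (Function.leftLim u t) = deriv z t := by
    intro t
    refine tendsto_nhds_unique ((hF.tendsto _).comp (h.tendsto_leftLim t))
      (((hw.tendsto t).mono_left nhdsWithin_le_nhds).congr' ?_)
    filter_upwards [hlt t (h.eventually_notMem_jumpSet t)] with τ hτ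
    exact (h.first_eq τ hτ).symm
  have hR : ∀ t, F f up s (Function.rightLim u t) = deriv z t := by
    intro t
    refine tendsto_nhds_unique ((hF.tendsto _).comp (h.tendsto_rightLim t))
      (((hw.tendsto t).mono_left nhdsWithin_le_nhds).congr' ?_)
    filter_upwards [hgt t (h.eventually_notMem_jumpSet t)] with τ hτ
    exact (h.first_eq τ hτ).symm
  -- at a point of continuity the interval between `uL t` and `uR t` is empty
  have hjump : ∀ t, Function.leftLim u t ≠ Function.rightLim u t →
      IsAdmissibleShock f (Function.leftLim u t) (Function.rightLim u t) s := fun t ht =>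
    h.isAdmissibleShock_of_mem (h.mem_jumpSet_iff.2 ht)
  exact
    { hasDerivAt := fun t => (hzd t).hasDerivAt
      right_deriv := fun t => by
        refine hasDerivWithinAt_Ici_of_tendsto_deriv (s := (jumpSet u)ᶜ)
          (fun τ hτ => (h.differentiableAt_deriv τ hτ).differentiableWithinAt)
          hw.continuousWithinAt (hgt t (h.eventually_notMem_jumpSet t)) ?_
        refine ((((hzd.continuous.tendsto t).mono_left nhdsWithin_le_nhds).sub
          (h.tendsto_rightLim t)).div_const ε).congr' ?_
        filter_upwards [hgt t (h.eventually_notMem_jumpSet t)] with τ hτ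
        exact (hdd τ hτ).symm
      left_deriv := fun t => by
        refine hasDerivWithinAt_Iic_of_tendsto_deriv (s := (jumpSet u)ᶜ)
          (fun τ hτ => (h.differentiableAt_deriv τ hτ).differentiableWithinAt)
          hw.continuousWithinAt (hlt t (h.eventually_notMem_jumpSet t)) ?_
        refine ((((hzd.continuous.tendsto t).mono_left nhdsWithin_le_nhds).sub
          (h.tendsto_leftLim t)).div_const ε).congr' ?_
        filter_upwards [hlt t (h.eventually_notMem_jumpSet t)] with τ hτ
        exact (hdd τ hτ).symm
      uR_right := fun t => (h.tendsto_rightLim t).congr' (((evR t).filter_mono (hgt t)).mono fun _ => Eq.symm)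
      uL_right := fun t => (h.tendsto_rightLim t).congr' (((evL t).filter_mono (hgt t)).mono fun _ => Eq.symm)
      uR_left := fun t => (h.tendsto_leftLim t).congr' (((evR t).filter_mono (hlt t)).mono fun _ => Eq.symm)
      uL_left := fun t => (h.tendsto_leftLim t).congr' (((evL t).filter_mono (hlt t)).mono fun _ => Eq.symm)
      left_eq := hL
      right_eq := hR
      lt_of_down := fun t v hv => hL t ▸ (hjump t (hv.1.trans hv.2).ne').F_lt up hv
      lt_of_up := fun t v hv => hL t ▸ (hjump t (hv.1.trans hv.2).ne).lt_F up hv }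

end IsAdmissibleProfile

theorem IsOneSidedProfile.shift {G : ℝ → ℝ} {ε : ℝ} {z w uL uR : ℝ → ℝ}
    (h : IsOneSidedProfile G ε z w uL uR) (c : ℝ) :
    IsOneSidedProfile G ε (fun t => z (t + c)) (fun t => w (t + c)) (fun t => uL (t + c))
      (fun t => uR (t + c)) := by
  have hr : ∀ t, Tendsto (fun t => t + c) (𝓝[>] t) (𝓝[>] (t + c)) := fun t =>
    (continuous_add_const c).continuousWithinAt.tendsto_nhdsWithin
      fun x hx => add_lt_add_left (mem_Ioi.1 hx) c
  have hl : ∀ t, Tendsto (fun t => t + c) (𝓝[<] t) (𝓝[<] (t + c)) := fun t =>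
    (continuous_add_const c).continuousWithinAt.tendsto_nhdsWithin
      fun x hx => add_lt_add_left (mem_Iio.1 hx) c
  exact
    { hasDerivAt := fun t => (h.hasDerivAt (t + c)).comp_add_const t c
      right_deriv := fun t =>
        ((h.right_deriv (t + c)).scomp t ((hasDerivAt_id t).add_const c).hasDerivWithinAt
          (s := Ici t) (fun x hx => by simpa using hx)).congr_deriv (by simp)
      left_deriv := fun t =>
        ((h.left_deriv (t + c)).scomp t ((hasDerivAt_id t).add_const c).hasDerivWithinAt
          (s := Iic t) (fun x hx => by simpa using hx)).congr_deriv (by simp)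
      uR_right := fun t => (h.uR_right (t + c)).comp (hr t)
      uL_right := fun t => (h.uL_right (t + c)).comp (hr t)
      uR_left := fun t => (h.uR_left (t + c)).comp (hl t)
      uL_left := fun t => (h.uL_left (t + c)).comp (hl t)
      left_eq := fun t => h.left_eq (t + c)
      right_eq := fun t => h.right_eq (t + c)
      lt_of_down := fun t => h.lt_of_down (t + c)
      lt_of_up := fun t => h.lt_of_up (t + c) }

theorem exists_eq_of_tendsto {z : ℝ → ℝ} {a b c : ℝ} (hz : Continuous z)
    (hbot : Tendsto z atBot (𝓝 a)) (htop : Tendsto z atTop (𝓝 b)) (hbc : b < c) (hca : c < a) :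
    ∃ t, z t = c := by
  obtain ⟨x, hx⟩ := (hbot.eventually_const_lt hca).exists
  obtain ⟨y, hy⟩ := (htop.eventually_lt_const hbc).exists
  exact mem_range_of_exists_le_of_exists_ge hz ⟨y, hy.le⟩ ⟨x, hx.le⟩

/-- Uniqueness up to translation, for every `ε > 0`: both `z`-components take the value
`(um + up) / 2`, and after a translation that makes them meet there they coincide. -/
theorem IsAdmissibleProfile.eq_shift {f : ℝ → ℝ} (hf : ContDiff ℝ 2 f) {um up s ε : ℝ}
    (hlt : up < um) (hε : 0 < ε) {u₁ z₁ u₂ z₂ : ℝ → ℝ}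
    (h₁ : IsAdmissibleProfile f um up s ε u₁ z₁) (h₂ : IsAdmissibleProfile f um up s ε u₂ z₂) :
    ∃ h : ℝ, (∀ ξ, z₂ ξ = z₁ (ξ + h)) ∧
      (∀ ξ, ξ ∈ jumpSet u₂ ↔ ξ + h ∈ jumpSet u₁) ∧
      (∀ ξ, ξ ∉ jumpSet u₂ → u₂ ξ = u₁ (ξ + h)) := by
  obtain ⟨t₁, ht₁⟩ := exists_eq_of_tendsto h₁.contDiff.continuous h₁.tendsto_atBot
    h₁.tendsto_atTop (c := (up + um) / 2) (by linarith) (by linarith)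
  obtain ⟨t₂, ht₂⟩ := exists_eq_of_tendsto h₂.contDiff.continuous h₂.tendsto_atBot
    h₂.tendsto_atTop (c := (up + um) / 2) (by linarith) (by linarith)
  have p₁ := (h₁.isOneSidedProfile hf hε).shift (t₁ - t₂)
  have p₂ := h₂.isOneSidedProfile hf hε
  have htop : Tendsto (fun t => z₂ t - z₁ (t + (t₁ - t₂))) atTop (𝓝 0) := by
    simpa using h₂.tendsto_atTop.sub
      (h₁.tendsto_atTop.comp (tendsto_atTop_add_const_right _ (t₁ - t₂) tendsto_id))
  have hbot : Tendsto (fun t => z₂ t - z₁ (t + (t₁ - t₂))) atBot (𝓝 0) := by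
    simpa using h₂.tendsto_atBot.sub
      (h₁.tendsto_atBot.comp (tendsto_atBot_add_const_right _ (t₁ - t₂) tendsto_id))
  have hz : ∀ t, z₂ t = z₁ (t + (t₁ - t₂)) :=
    IsOneSidedProfile.z_eq_of_touch hε p₂ p₁ htop hbot (t₀ := t₂) (by simp [ht₁, ht₂])
  have hw : deriv z₂ = fun t => deriv z₁ (t + (t₁ - t₂)) :=
    funext fun t => ((p₂.hasDerivAt t).congr_of_eventuallyEq
      (Eventually.of_forall fun t => (hz t).symm)).unique (p₁.hasDerivAt t)
  have hε' := hε.ne'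
  -- the one-sided derivatives of `z'` determine the one-sided limits of `u`
  have hR : ∀ t, Function.rightLim u₂ t = Function.rightLim u₁ (t + (t₁ - t₂)) := by
    intro t
    have := (uniqueDiffWithinAt_Ici t).eq_deriv _ (hw ▸ p₂.right_deriv t) (p₁.right_deriv t)
    rw [div_left_inj' hε', hz t] at this
    linarith
  have hL : ∀ t, Function.leftLim u₂ t = Function.leftLim u₁ (t + (t₁ - t₂)) := by
    intro t
    have := (uniqueDiffWithinAt_Iic t).eq_deriv _ (hw ▸ p₂.left_deriv t) (p₁.left_deriv t)
    rw [div_left_inj' hε', hz t] at this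
    linarith
  have hJ : ∀ ξ, ξ ∈ jumpSet u₂ ↔ ξ + (t₁ - t₂) ∈ jumpSet u₁ := fun ξ => by
    rw [h₂.mem_jumpSet_iff, h₁.mem_jumpSet_iff, hR, hL]
  refine ⟨t₁ - t₂, hz, hJ, fun ξ hξ => ?_⟩
  rw [← IsAdmissibleProfile.rightLim_eq_of_notMem hξ, hR,
    IsAdmissibleProfile.rightLim_eq_of_notMem (mt (hJ ξ).2 hξ)]

/-! ### The singular equation `(1 + η') η = γ` -/

open scoped BoundedContinuousFunction

/-- The implicit discretisation with step `h` of `(1 + η') η = γ`, namely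
`η(x) = (1 - h) η(x - h η(x)) + h γ(x)`, has a solution that is `1/2`-Lipschitz. The right-hand
side maps `1/2`-Lipschitz functions to such functions, and contracts the sup norm on them. -/
theorem exists_discrete_solution {γ : ℝ → ℝ} {M h : ℝ} (hM : ∀ x, |γ x| ≤ M)
    (hγ : ∀ x y, |γ x - γ y| ≤ 1 / 4 * |x - y|) (h0 : 0 < h) (h1 : h < 1) :
    ∃ η : ℝ → ℝ, (∀ x y, |η x - η y| ≤ 1 / 2 * |x - y|) ∧ (∀ x, |η x| ≤ M) ∧
      ∀ x, η x = (1 - h) * η (x - h * η x) + h * γ x := by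
  have hγc : Continuous γ := (LipschitzWith.of_dist_le_mul (K := 1 / 4) (by
    simpa [Real.dist_eq] using hγ)).continuous
  have hM0 : 0 ≤ M := (abs_nonneg _).trans (hM 0)
  have hbound : ∀ (η : ℝ →ᵇ ℝ) x, ‖(1 - h) * η (x - h * η x) + h * γ x‖ ≤
      (1 - h) * ‖η‖ + h * M := by
    intro η x
    refine (norm_add_le _ _).trans (add_le_add ?_ ?_)
    · rw [norm_mul, Real.norm_of_nonneg (sub_nonneg.2 h1.le)]
      exact mul_le_mul_of_nonneg_left (η.norm_coe_le_norm _) (sub_nonneg.2 h1.le)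
    · rw [norm_mul, Real.norm_of_nonneg h0.le]
      exact mul_le_mul_of_nonneg_left (hM x) h0.le
  let T : (ℝ →ᵇ ℝ) → (ℝ →ᵇ ℝ) := fun η =>
    BoundedContinuousFunction.ofNormedAddCommGroup
      (fun x => (1 - h) * η (x - h * η x) + h * γ x) (by fun_prop) ((1 - h) * ‖η‖ + h * M) (hbound η)
  have hT : ∀ (η : ℝ →ᵇ ℝ) x, T η x = (1 - h) * η (x - h * η x) + h * γ x := fun _ _ => rfl
  let S : Set (ℝ →ᵇ ℝ) := {η | ∀ x y, |η x - η y| ≤ 1 / 2 * |x - y|}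
  have hSc : IsClosed S := by
    have : S = ⋂ x, ⋂ y, {η : ℝ →ᵇ ℝ | |η x - η y| ≤ 1 / 2 * |x - y|} := by
      ext η
      simp [S]
    rw [this]
    refine isClosed_iInter fun x => isClosed_iInter fun y => isClosed_le ?_ continuous_const
    exact ((continuous_eval_const x).sub
      (continuous_eval_const y)).abs
  have hST : MapsTo T S S := by
    intro η hη x y
    rw [hT, hT]
    have e1 := hη (x - h * η x) (y - h * η y)
    have e2 : |x - h * η x - (y - h * η y)| ≤ |x - y| + h * |η x - η y| := by
      have : x - h * η x - (y - h * η y) = (x - y) - h * (η x - η y) := by ring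
      rw [this]
      refine (abs_sub _ _).trans ?_
      rw [abs_mul, abs_of_pos h0]
    have e3 := hη x y
    have e4 := hγ x y
    have e5 : (1 - h) * η (x - h * η x) + h * γ x - ((1 - h) * η (y - h * η y) + h * γ y)
        = (1 - h) * (η (x - h * η x) - η (y - h * η y)) + h * (γ x - γ y) := by ring
    rw [e5]
    refine (abs_add_le _ _).trans ?_
    rw [abs_mul, abs_mul, abs_of_pos h0, abs_of_pos (sub_pos.2 h1)]
    have e6 : |η (x - h * η x) - η (y - h * η y)| ≤ 1 / 2 * (1 + h / 2) * |x - y| := by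
      nlinarith
    have e7 := mul_le_mul_of_nonneg_left e6 (sub_nonneg.2 h1.le)
    have e8 := mul_le_mul_of_nonneg_left e4 h0.le
    nlinarith [mul_nonneg (sq_nonneg h) (abs_nonneg (x - y))]
  have hcontr : ContractingWith (Real.toNNReal (1 - h / 2)) (hST.restrict T S S) := by
    refine ⟨?_, LipschitzWith.of_dist_le_mul ?_⟩
    · rw [Real.toNNReal_lt_one]
      linarith
    · rintro ⟨η, hη⟩ ⟨θ, hθ⟩
      rw [Real.coe_toNNReal _ (by linarith)]
      change dist (T η) (T θ) ≤ (1 - h / 2) * dist η θ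
      rw [BoundedContinuousFunction.dist_le (mul_nonneg (by linarith) dist_nonneg)]
      intro x
      rw [hT, hT, Real.dist_eq]
      have e0 := η.dist_coe_le_dist (g := θ) x
      have e0' := η.dist_coe_le_dist (g := θ) (x - h * θ x)
      rw [Real.dist_eq] at e0 e0'
      have e1 := hη (x - h * η x) (x - h * θ x)
      have e2 : |x - h * η x - (x - h * θ x)| = h * |η x - θ x| := by
        have : x - h * η x - (x - h * θ x) = -(h * (η x - θ x)) := by ring
        rw [this, abs_neg, abs_mul, abs_of_pos h0]
      have e3 : (1 - h) * η (x - h * η x) + h * γ x - ((1 - h) * θ (x - h * θ x) + h * γ x)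
        = (1 - h) * ((η (x - h * η x) - η (x - h * θ x)) + (η (x - h * θ x) - θ (x - h * θ x)))
        := by ring
      rw [e3, abs_mul, abs_of_pos (sub_pos.2 h1)]
      have e4 := abs_add_le (η (x - h * η x) - η (x - h * θ x))
        (η (x - h * θ x) - θ (x - h * θ x))
      have e5 : |(η (x - h * η x) - η (x - h * θ x)) + (η (x - h * θ x) - θ (x - h * θ x))| ≤
          (1 + h / 2) * dist η θ := by nlinarith
      have e6 := mul_le_mul_of_nonneg_left e5 (sub_nonneg.2 h1.le)
      nlinarith [mul_nonneg (sq_nonneg h) (dist_nonneg (x := η) (y := θ))]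
  obtain ⟨η, hηS, hfix, -⟩ := hcontr.exists_fixedPoint' hSc.isComplete hST
    (x := 0) (by intro x y; simp) (edist_ne_top _ _)
  have heq : ∀ x, η x = (1 - h) * η (x - h * η x) + h * γ x := fun x => by
    conv_lhs => rw [← hfix.eq]
    rw [hT]
  have hnorm : ‖η‖ ≤ (1 - h) * ‖η‖ + h * M := by
    calc ‖η‖ = ‖T η‖ := by rw [hfix.eq]
      _ ≤ _ := BoundedContinuousFunction.norm_ofNormedAddCommGroup_le _
        (add_nonneg (mul_nonneg (sub_nonneg.2 h1.le) (norm_nonneg _)) (mul_nonneg h0.le hM0))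
        (hbound η)
  refine ⟨η, hηS, fun x => (η.norm_coe_le_norm x).trans ?_, heq⟩
  exact le_of_mul_le_mul_left (by linarith) h0

/-- If from every point of `[y, x]` one can step to the left by at most `b` without decreasing
`q`, then one can reach a point within `b` to the left of `y` this way. -/
theorem exists_mem_Icc_le_of_step {q : ℝ → ℝ} {x y b : ℝ} (hq : Continuous q) (hyx : y ≤ x)
    (hb : 0 ≤ b) (hstep : ∀ t ∈ Icc y x, ∃ t' ∈ Ico (t - b) t, q t ≤ q t') :
    ∃ m ∈ Icc (y - b) y, q x ≤ q m := by
  have hcomp : IsCompact ({t | q x ≤ q t} ∩ Icc (y - b) x) :=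
    isCompact_Icc.inter_left (isClosed_le continuous_const hq)
  obtain ⟨m, ⟨hqm, hm⟩, hmin⟩ := hcomp.exists_isLeast
    ⟨x, le_refl (q x), by linarith, le_rfl⟩
  refine ⟨m, ⟨hm.1, ?_⟩, hqm⟩
  by_contra hc
  rw [not_le] at hc
  obtain ⟨t', ht', hqt⟩ := hstep m ⟨hc.le, hm.2⟩
  have := hmin ⟨le_trans hqm hqt, ⟨by linarith [ht'.1], ht'.2.le.trans hm.2⟩⟩
  exact absurd ht'.2 (not_lt.2 this)

section Limit

variable {ι : Type*} {l : Filter ι} {h : ι → ℝ} {ηs : ι → ℝ → ℝ} {η γ : ℝ → ℝ} {M : ℝ}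

/-- A pointwise limit of solutions of the discretised equation solves `(1 + η') η = γ` where it is
positive. The discrete equation prescribes the difference quotient of `ηs i` over the step from
`t` to `t - h η(t)`; chaining such steps gives the increments over macroscopic distances, and these
pass to the limit. -/
theorem hasDerivAt_limit_of_pos [l.NeBot] (hh : ∀ i, 0 < h i) (hl : Tendsto h l (𝓝 0))
    (hlip : ∀ i x y, |ηs i x - ηs i y| ≤ 1 / 2 * |x - y|) (hM : ∀ i x, |ηs i x| ≤ M)
    (heq : ∀ i x, ηs i x = (1 - h i) * ηs i (x - h i * ηs i x) + h i * γ x)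
    (hγ : ∀ x y, |γ x - γ y| ≤ 1 / 4 * |x - y|)
    (hlim : ∀ x, Tendsto (fun i => ηs i x) l (𝓝 (η x))) {x₀ : ℝ} (hx₀ : 0 < η x₀) :
    HasDerivAt η (γ x₀ / η x₀ - 1) x₀ := by
  set D := γ x₀ / η x₀ - 1 with hD
  have hDη : γ x₀ - η x₀ - D * η x₀ = 0 := by
    rw [hD]
    field_simp
    ring
  have hcont : ∀ i, Continuous (ηs i) := fun i =>
    (LipschitzWith.of_dist_le_mul (K := 1 / 2) (by
      simpa [Real.dist_eq] using hlip i)).continuous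
  have key : ∀ ω > 0, ∃ δ > 0, ∀ x ∈ Ioo (x₀ - δ) (x₀ + δ), ∀ y ∈ Ioo (x₀ - δ) (x₀ + δ), y ≤ x →
      |η x - η y - D * (x - y)| ≤ ω * (x - y) := by
    intro ω hω
    -- `δ` bounds the distance to `x₀`, the error of `ηs i x₀` and the step length; the residual of
    -- the equation with `D` as slope is then at most `4 C δ ≤ ω η(x₀) / 2 ≤ ω ηs i t`
    set C := 1 + |D| with hC
    have hC1 : 1 ≤ C := by linarith [abs_nonneg D]
    set δ := min (η x₀ / 3) (ω * η x₀ / (8 * C)) with hδ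
    have hδ0 : 0 < δ := lt_min (by linarith) (by positivity)
    have hδ1 : δ ≤ η x₀ / 3 := min_le_left _ _
    have hδ2 : 8 * C * δ ≤ ω * η x₀ := by
      have := min_le_right (η x₀ / 3) (ω * η x₀ / (8 * C))
      rw [← hδ, le_div_iff₀ (by positivity)] at this
      linarith
    refine ⟨δ, hδ0, fun x hx y hy hyx => ?_⟩
    have ev1 : ∀ᶠ i in l, |ηs i x₀ - η x₀| < δ := by
      simpa [Real.dist_eq] using (Metric.tendsto_nhds.1 (hlim x₀)) δ hδ0
    have ev2 : ∀ᶠ i in l, h i * M < δ := by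
      have : Tendsto (fun i => h i * M) l (𝓝 0) := by simpa using hl.mul_const M
      exact this.eventually_lt_const hδ0
    have hM0 : ∀ i, 0 ≤ h i * M := fun i =>
      mul_nonneg (hh i).le ((abs_nonneg _).trans (hM i 0))
    have hstep : ∀ᶠ i in l, ∀ t ∈ Icc y x,
        t - h i * ηs i t ∈ Ico (t - h i * M) t ∧
        |ηs i t - ηs i (t - h i * ηs i t) - D * (h i * ηs i t)| ≤ ω * (h i * ηs i t) := by
      filter_upwards [ev1, ev2] with i hi1 hi2 t ht
      have hh0 := hh i
      have htx : |t - x₀| ≤ δ :=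
        abs_le.2 ⟨by linarith [hy.1, ht.1], by linarith [hx.2, ht.2]⟩
      have a1 : |ηs i t - η x₀| ≤ 3 / 2 * δ := by
        have := abs_sub_le (ηs i t) (ηs i x₀) (η x₀)
        have := hlip i t x₀
        linarith
      have a2 : η x₀ / 2 ≤ ηs i t := by linarith [(abs_le.1 a1).1]
      have a3 : ηs i t ≤ M := (le_abs_self _).trans (hM i t)
      have a4 : 0 < h i * ηs i t := mul_pos hh0 (by linarith)
      have a5 : |ηs i (t - h i * ηs i t) - ηs i t| ≤ 1 / 2 * δ := by
        refine (hlip i _ _).trans ?_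
        have : t - h i * ηs i t - t = -(h i * ηs i t) := by ring
        rw [this, abs_neg, abs_of_pos a4]
        have := mul_le_mul_of_nonneg_left a3 hh0.le
        linarith
      have a6 : |γ t - γ x₀| ≤ 1 / 4 * δ := (hγ t x₀).trans (by linarith)
      have a7 : |γ t - ηs i (t - h i * ηs i t) - D * ηs i t| ≤ ω * ηs i t := by
        have e : γ t - ηs i (t - h i * ηs i t) - D * ηs i t =
            (γ t - γ x₀) - (ηs i (t - h i * ηs i t) - ηs i t) - (1 + D) * (ηs i t - η x₀) := by
          linear_combination hDη
        have b1 : |1 + D| ≤ C := (abs_add_le _ _).trans (by simp [hC])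
        have b2 : |(1 + D) * (ηs i t - η x₀)| ≤ C * (3 / 2 * δ) := by
          rw [abs_mul]
          exact mul_le_mul b1 a1 (abs_nonneg _) (by linarith)
        have b3 := abs_sub ((γ t - γ x₀) - (ηs i (t - h i * ηs i t) - ηs i t))
          ((1 + D) * (ηs i t - η x₀))
        have b4 := abs_sub (γ t - γ x₀) (ηs i (t - h i * ηs i t) - ηs i t)
        have b5 : δ ≤ C * δ := le_mul_of_one_le_left hδ0.le hC1
        have b6 := mul_le_mul_of_nonneg_left a2 hω.le
        rw [e]
        linarith
      refine ⟨⟨?_, by linarith⟩, ?_⟩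
      · have := mul_le_mul_of_nonneg_left a3 hh0.le
        linarith
      · have e : ηs i t - ηs i (t - h i * ηs i t) - D * (h i * ηs i t) =
            h i * (γ t - ηs i (t - h i * ηs i t) - D * ηs i t) := by
          linear_combination heq i t
        rw [e, abs_mul, abs_of_pos hh0]
        have := mul_le_mul_of_nonneg_left a7 hh0.le
        linarith
    -- replacing the end point of the chain by `y` costs a multiple of the step size
    have hfin : ∀ᶠ i in l, |ηs i x - ηs i y - D * (x - y)| ≤
        ω * (x - y) + (1 / 2 + |D| + ω) * (h i * M) := by
      filter_upwards [hstep] with i hi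
      have hup : ∀ σ ∈ ({1, -1} : Set ℝ), σ * (ηs i x - ηs i y - D * (x - y)) ≤
          ω * (x - y) + (1 / 2 + |D| + ω) * (h i * M) := by
        intro σ hσ
        have hσ1 : |σ| = 1 := by rcases hσ with rfl | rfl <;> simp
        have hc := hcont i
        obtain ⟨m, hm, hqm⟩ := exists_mem_Icc_le_of_step
          (q := fun t => σ * (ηs i t - D * t) - ω * t) (b := h i * M) (by fun_prop) hyx (hM0 i)
          (fun t ht => ⟨t - h i * ηs i t, (hi t ht).1, by
            have h1 := (hi t ht).2
            have h2 : σ * (ηs i t - ηs i (t - h i * ηs i t) - D * (h i * ηs i t)) ≤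
                ω * (h i * ηs i t) :=
              (le_abs_self _).trans (by rwa [abs_mul, hσ1, one_mul])
            linarith⟩)
        have h3 : σ * (ηs i m - ηs i y - D * (m - y)) ≤ (1 / 2 + |D|) * (h i * M) := by
          have hmy : |m - y| ≤ h i * M := abs_le.2 ⟨by linarith [hm.1], by linarith [hm.2, hM0 i]⟩
          refine (le_abs_self _).trans ?_
          rw [abs_mul, hσ1, one_mul]
          refine (abs_sub _ _).trans ?_
          rw [abs_mul]
          have := hlip i m y
          have := mul_le_mul_of_nonneg_left hmy (abs_nonneg D)
          linarith
        have h4 : ω * (y - m) ≤ ω * (h i * M) :=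
          mul_le_mul_of_nonneg_left (by linarith [hm.1]) hω.le
        linarith
      exact abs_le.2 ⟨by linarith [hup (-1) (by simp)], by linarith [hup 1 (by simp)]⟩
    have t1 : Tendsto (fun i => |ηs i x - ηs i y - D * (x - y)|) l
        (𝓝 |η x - η y - D * (x - y)|) := (((hlim x).sub (hlim y)).sub_const _).abs
    have t2 : Tendsto (fun i => ω * (x - y) + (1 / 2 + |D| + ω) * (h i * M)) l
        (𝓝 (ω * (x - y))) := by
      simpa using ((hl.mul_const M).const_mul (1 / 2 + |D| + ω)).const_add (ω * (x - y))
    exact le_of_tendsto_of_tendsto t1 t2 hfin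
  rw [hasDerivAt_iff_isLittleO, Asymptotics.isLittleO_iff]
  intro ω hω
  obtain ⟨δ, hδ, hkey⟩ := key ω hω
  filter_upwards [Ioo_mem_nhds (show x₀ - δ < x₀ by linarith) (show x₀ < x₀ + δ by linarith)]
    with x hx
  have hx0 : x₀ ∈ Ioo (x₀ - δ) (x₀ + δ) := ⟨by linarith, by linarith⟩
  rw [Real.norm_eq_abs, Real.norm_eq_abs, smul_eq_mul]
  rcases le_total x₀ x with hle | hle
  · have := hkey x hx x₀ hx0 hle
    rwa [abs_of_nonneg (sub_nonneg.2 hle), mul_comm (x - x₀) D]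
  · have := hkey x₀ hx0 x hx hle
    rw [abs_of_nonpos (sub_nonpos.2 hle), ← abs_neg]
    convert this using 2 <;> ring

theorem hasDerivAt_limit [l.NeBot] (hh : ∀ i, 0 < h i) (hl : Tendsto h l (𝓝 0))
    (hlip : ∀ i x y, |ηs i x - ηs i y| ≤ 1 / 2 * |x - y|) (hM : ∀ i x, |ηs i x| ≤ M)
    (heq : ∀ i x, ηs i x = (1 - h i) * ηs i (x - h i * ηs i x) + h i * γ x)
    (hγ : ∀ x y, |γ x - γ y| ≤ 1 / 4 * |x - y|)
    (hlim : ∀ x, Tendsto (fun i => ηs i x) l (𝓝 (η x))) {x₀ : ℝ} (hx₀ : η x₀ ≠ 0) :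
    HasDerivAt η (γ x₀ / η x₀ - 1) x₀ := by
  rcases hx₀.lt_or_gt with hneg | hpos
  · -- the equation is invariant under `x ↦ -x`, `η ↦ -η`, `γ ↦ -γ`
    have habs : ∀ x y : ℝ, |(-x) - (-y)| = |x - y| := fun x y => by
      rw [neg_sub_neg, abs_sub_comm]
    have hd := hasDerivAt_limit_of_pos (ηs := fun i x => -ηs i (-x)) (η := fun x => -η (-x))
      (γ := fun x => -γ (-x)) (x₀ := -x₀) hh hl
      (fun i x y => by
        rw [neg_sub_neg, abs_sub_comm, ← habs x y]; exact hlip i (-x) (-y))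
      (fun i x => by rw [abs_neg]; exact hM i (-x))
      (fun i x => by
        have := heq i (-x)
        have e : -(x - h i * -ηs i (-x)) = -x - h i * ηs i (-x) := by ring
        rw [e]
        linarith)
      (fun x y => by
        rw [neg_sub_neg, abs_sub_comm, ← habs x y]; exact hγ (-x) (-y))
      (fun x => (hlim (-x)).neg) (by simpa using hneg)
    have hd2 := (hd.comp x₀ (hasDerivAt_neg x₀)).neg
    refine (hd2.congr_of_eventuallyEq (Eventually.of_forall fun x => ?_)).congr_deriv ?_
    · simp
    · simp
  · exact hasDerivAt_limit_of_pos hh hl hlip hM heq hγ hlim hpos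

end Limit

/-- The singular equation `(1 + η') η = γ` with small Lipschitz right-hand side has a Lipschitz
solution. The bound on `γ - η` makes `η` vanish exactly where `γ` does, and `γ / η ≥ 1/2`
elsewhere. -/
theorem exists_lipschitz_solution {γ : ℝ → ℝ} {M : ℝ} (hM : ∀ x, |γ x| ≤ M)
    (hγ : ∀ x y, |γ x - γ y| ≤ 1 / 4 * |x - y|) :
    ∃ η : ℝ → ℝ, (∀ x y, |η x - η y| ≤ 1 / 2 * |x - y|) ∧ (∀ x, |γ x - η x| ≤ 1 / 2 * |η x|) ∧
      ∀ x, η x ≠ 0 → HasDerivAt η (γ x / η x - 1) x := by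
  set h : ℕ → ℝ := fun n => 1 / ((n : ℝ) + 2) with hh
  have h0 : ∀ n, 0 < h n := fun n => by positivity
  have h1 : ∀ n, h n < 1 := fun n => by
    rw [hh]
    simp only
    rw [div_lt_one (by positivity)]
    linarith [(Nat.cast_nonneg n : (0 : ℝ) ≤ n)]
  choose ηs hlip hbd heq using fun n => exists_discrete_solution hM hγ (h0 n) (h1 n)
  have hb1 : ∀ n x, |ηs n x - ηs n (x - h n * ηs n x)| ≤ 1 / 2 * (h n * |ηs n x|) := by
    intro n x
    have := hlip n x (x - h n * ηs n x)
    rwa [sub_sub_cancel, abs_mul, abs_of_pos (h0 n)] at this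
  -- `h γ` and `h η` differ by `(1 - h)` times an increment of `η` over the step `h η`
  have hb2 : ∀ n x, |γ x - ηs n x| ≤ 1 / 2 * |ηs n x| := by
    intro n x
    have e : h n * (γ x - ηs n x) = (1 - h n) * (ηs n x - ηs n (x - h n * ηs n x)) := by
      linear_combination -heq n x
    have := congrArg abs e
    rw [abs_mul, abs_mul, abs_of_pos (h0 n), abs_of_pos (sub_pos.2 (h1 n))] at this
    have h3 : (1 - h n) * |ηs n x - ηs n (x - h n * ηs n x)| ≤
        |ηs n x - ηs n (x - h n * ηs n x)| :=
      mul_le_of_le_one_left (abs_nonneg _) (by linarith [h0 n])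
    refine le_of_mul_le_mul_left ?_ (h0 n)
    linarith [hb1 n x]
  have hl : Tendsto h (hyperfilter ℕ : Filter ℕ) (𝓝 0) := by
    refine Tendsto.mono_left ?_ Nat.hyperfilter_le_atTop
    exact tendsto_const_nhds.div_atTop
      (tendsto_atTop_add_const_right _ _ tendsto_natCast_atTop_atTop)
  have hex : ∀ x, ∃ y, Tendsto (fun n => ηs n x) (hyperfilter ℕ : Filter ℕ) (𝓝 y) := by
    intro x
    obtain ⟨y, -, hy⟩ := (isCompact_Icc (a := -M) (b := M)).ultrafilter_le_nhds'
      ((hyperfilter ℕ).map fun n => ηs n x)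
      (Ultrafilter.mem_map.2 (univ_mem' fun n => abs_le.1 (hbd n x)))
    exact ⟨y, hy⟩
  choose η hη using hex
  refine ⟨η, fun x y => ?_, fun x => ?_, fun x hx =>
    hasDerivAt_limit h0 hl hlip hbd heq hγ hη hx⟩
  · exact le_of_tendsto ((hη x).sub (hη y)).abs (Eventually.of_forall fun n => hlip n x y)
  · exact le_of_tendsto_of_tendsto' ((hη x).const_sub (γ x)).abs ((hη x).abs.const_mul _)
      fun n => hb2 n x

/-- The inverse `φ` of `ψ(x) = x + η(x)`, where `(1 + η') η = γ`: along it, any primitive `Γ` of `γ`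
satisfies `(Γ ∘ φ)'(z) = z - φ(z)`. Also where `γ` vanishes, since there `Γ' = 0` and `φ` is
Lipschitz. -/
theorem exists_slow_manifold {γ : ℝ → ℝ} {M : ℝ} (hM : ∀ x, |γ x| ≤ M)
    (hγ : ∀ x y, |γ x - γ y| ≤ 1 / 4 * |x - y|) :
    ∃ φ : ℝ → ℝ, StrictMono φ ∧ (∀ a b, |φ a - φ b| ≤ 2 * |a - b|) ∧
      (∀ c, γ c = 0 → φ c = c) ∧
      ∀ (Γ : ℝ → ℝ) (z : ℝ), HasDerivAt Γ (γ (φ z)) (φ z) →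
        HasDerivAt (fun z => Γ (φ z)) (z - φ z) z := by
  obtain ⟨η, hlip, hcl, hder⟩ := exists_lipschitz_solution hM hγ
  set ψ : ℝ → ℝ := fun x => x + η x with hψ
  have hηc : Continuous η := (LipschitzWith.of_dist_le_mul (K := 1 / 2) (by
      simpa [Real.dist_eq] using hlip)).continuous
  have hψc : Continuous ψ := continuous_id.add hηc
  have hexp : ∀ {x y}, x ≤ y → (y - x) / 2 ≤ ψ y - ψ x := by
    intro x y hxy
    have := (abs_le.1 (hlip y x)).1
    rw [abs_of_nonneg (sub_nonneg.2 hxy)] at this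
    simp only [hψ]
    linarith
  have hmono : StrictMono ψ := fun x y hxy => by
    have := hexp hxy.le
    linarith
  have hsurj : Function.Surjective ψ := by
    intro c
    have h0 := abs_nonneg (c - ψ 0)
    have h1 := hexp (x := -(2 * |c - ψ 0|)) (y := 0) (by linarith)
    have h2 := hexp (x := 0) (y := 2 * |c - ψ 0|) (by linarith)
    exact mem_range_of_exists_le_of_exists_ge hψc
      ⟨-(2 * |c - ψ 0|), by linarith [neg_abs_le (c - ψ 0)]⟩
      ⟨2 * |c - ψ 0|, by linarith [le_abs_self (c - ψ 0)]⟩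
  set e := hmono.orderIsoOfSurjective ψ hsurj with he
  have hψe : ∀ z, ψ (e.symm z) = z := fun z => e.apply_symm_apply z
  have hφlip : ∀ a b, |e.symm a - e.symm b| ≤ 2 * |a - b| := by
    have hle : ∀ a b, a ≤ b → |e.symm a - e.symm b| ≤ 2 * |a - b| := by
      intro a b hab
      have h1 := e.symm.monotone hab
      have h2 := hexp h1
      rw [hψe, hψe] at h2
      rw [abs_of_nonpos (sub_nonpos.2 h1), abs_of_nonpos (sub_nonpos.2 hab)]
      linarith
    intro a b
    rcases le_total a b with h | h
    · exact hle a b h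
    · rw [abs_sub_comm, abs_sub_comm a b]
      exact hle b a h
  have hφc : Continuous e.symm := e.symm.continuous
  refine ⟨e.symm, e.symm.strictMono, hφlip, fun c hc => ?_, fun Γ z hΓ => ?_⟩
  · have h1 := hcl c
    rw [hc, zero_sub, abs_neg] at h1
    have h2 : η c = 0 := abs_nonpos_iff.1 (by linarith [abs_nonneg (η c)])
    rw [OrderIso.symm_apply_eq]
    change c = c + η c
    rw [h2, add_zero]
  · have hz : z - e.symm z = η (e.symm z) := by
      have := hψe z
      simp only [hψ] at this
      linarith
    rw [hz]
    have hclz := hcl (e.symm z)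
    by_cases h0 : η (e.symm z) = 0
    · rw [h0] at hclz ⊢
      have hγ0 : γ (e.symm z) = 0 := by simpa using hclz
      rw [hγ0, hasDerivAt_iff_isLittleO] at hΓ
      rw [hasDerivAt_iff_isLittleO]
      simp only [smul_zero, sub_zero] at hΓ ⊢
      refine (hΓ.comp_tendsto (hφc.tendsto z)).trans_isBigO ?_
      exact Asymptotics.IsBigO.of_bound 2 (Eventually.of_forall fun x => hφlip x z)
    · have hγ0 : γ (e.symm z) ≠ 0 := by
        intro h
        rw [h, zero_sub, abs_neg] at hclz
        exact h0 (abs_nonpos_iff.1 (by linarith [abs_nonneg (η (e.symm z))]))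
      have hψd : HasDerivAt ψ (γ (e.symm z) / η (e.symm z)) (e.symm z) :=
        ((hasDerivAt_id (e.symm z)).add (hder _ h0)).congr_deriv (by ring)
      have hφd : HasDerivAt e.symm (γ (e.symm z) / η (e.symm z))⁻¹ z :=
        hψd.of_local_left_inverse hφc.continuousAt (div_ne_zero hγ0 h0)
          (Eventually.of_forall hψe)
      exact (hΓ.comp z hφd).congr_deriv (by field_simp)

/-! ### Connecting orbits and the continuous profile -/

/-- Separation of variables: a negative continuous vector field on `(a, b)` that vanishes at most
linearly at the end points has a solution defined for all times that connects `b` to `a`. -/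
theorem exists_connecting_orbit {W : ℝ → ℝ} {a b C : ℝ} (hab : a < b) (hC : 0 < C)
    (hW : ContinuousOn W (Ioo a b)) (hneg : ∀ v ∈ Ioo a b, W v < 0)
    (ha : ∀ v ∈ Ioo a b, -W v ≤ C * (v - a)) (hb : ∀ v ∈ Ioo a b, -W v ≤ C * (b - v)) :
    ∃ z : ℝ → ℝ, (∀ t, z t ∈ Ioo a b) ∧ (∀ t, HasDerivAt z (W (z t)) t) ∧
      Tendsto z atBot (𝓝 b) ∧ Tendsto z atTop (𝓝 a) := by
  set m := (a + b) / 2 with hm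
  have hmI : m ∈ Ioo a b := ⟨by linarith, by linarith⟩
  have hg : ContinuousOn (fun v => (-W v)⁻¹) (Ioo a b) :=
    hW.neg.inv₀ fun v hv => (neg_pos.2 (hneg v hv)).ne'
  set S : ℝ → ℝ := fun v => ∫ x in m..v, (-W x)⁻¹ with hS
  have hSd : ∀ v ∈ Ioo a b, HasDerivAt S (-W v)⁻¹ v := fun v hv =>
    intervalIntegral.integral_hasDerivAt_right
      ((hg.mono (ordConnected_Ioo.uIcc_subset hmI hv)).intervalIntegrable)
      (hg.stronglyMeasurableAtFilter isOpen_Ioo v hv)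
      (hg.continuousAt (isOpen_Ioo.mem_nhds hv))
  have hSm : S m = 0 := intervalIntegral.integral_same
  have hSc : ContinuousOn S (Ioo a b) := fun v hv => (hSd v hv).continuousAt.continuousWithinAt
  have hmono : StrictMonoOn S (Ioo a b) :=
    strictMonoOn_of_deriv_pos (convex_Ioo a b) hSc fun v hv => by
      rw [interior_Ioo] at hv
      rw [(hSd v hv).deriv]
      exact inv_pos.2 (neg_pos.2 (hneg v hv))
  -- comparison with the logarithm: `S` takes infinite values at the end points
  have hlow : MonotoneOn (fun v => S v - Real.log (v - a) / C) (Ioo a b) := by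
    have hd : ∀ v ∈ Ioo a b, HasDerivAt (fun v => S v - Real.log (v - a) / C)
        ((-W v)⁻¹ - 1 / (v - a) / C) v := fun v hv =>
      (hSd v hv).sub ((((hasDerivAt_id v).sub_const a).log (sub_pos.2 hv.1).ne').div_const C)
    refine monotoneOn_of_deriv_nonneg (convex_Ioo a b)
      (fun v hv => (hd v hv).continuousAt.continuousWithinAt)
      (fun v hv => (hd v (interior_subset hv)).differentiableAt.differentiableWithinAt)
      fun v hv => ?_
    rw [interior_Ioo] at hv
    rw [(hd v hv).deriv, div_div, one_div, mul_comm, sub_nonneg]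
    exact inv_anti₀ (neg_pos.2 (hneg v hv)) (ha v hv)
  have hhigh : MonotoneOn (fun v => S v + Real.log (b - v) / C) (Ioo a b) := by
    have hd : ∀ v ∈ Ioo a b, HasDerivAt (fun v => S v + Real.log (b - v) / C)
        ((-W v)⁻¹ + -1 / (b - v) / C) v := fun v hv =>
      (hSd v hv).add ((((hasDerivAt_id v).const_sub b).log (sub_pos.2 hv.2).ne').div_const C)
    refine monotoneOn_of_deriv_nonneg (convex_Ioo a b)
      (fun v hv => (hd v hv).continuousAt.continuousWithinAt)
      (fun v hv => (hd v (interior_subset hv)).differentiableAt.differentiableWithinAt)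
      fun v hv => ?_
    rw [interior_Ioo] at hv
    rw [(hd v hv).deriv, div_div, neg_div, one_div, mul_comm, ← sub_eq_add_neg, sub_nonneg]
    exact inv_anti₀ (neg_pos.2 (hneg v hv)) (hb v hv)
  -- the points at distance `e^{-C|t|}` times the half-length from an end make that bound `∓|t|`
  have hshrink : ∀ t : ℝ, 0 < Real.exp (-(C * |t|)) ∧ Real.exp (-(C * |t|)) ≤ 1 := fun t =>
    ⟨Real.exp_pos _, Real.exp_le_one_iff.2 (neg_nonpos.2 (by positivity))⟩
  have hex_low : ∀ t, ∃ v ∈ Ioo a b, S v ≤ t := by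
    intro t
    obtain ⟨h0, h1⟩ := hshrink t
    have h2 : (m - a) * Real.exp (-(C * |t|)) ≤ m - a :=
      mul_le_of_le_one_right (by linarith) h1
    have h3 : 0 < (m - a) * Real.exp (-(C * |t|)) := mul_pos (by linarith) h0
    have hv : a + (m - a) * Real.exp (-(C * |t|)) ∈ Ioo a b := ⟨by linarith, by linarith⟩
    refine ⟨_, hv, ?_⟩
    have h4 := hlow hv hmI (by linarith)
    simp only [hSm, add_sub_cancel_left] at h4
    rw [Real.log_mul (by linarith) h0.ne', Real.log_exp, add_div, neg_div,
      mul_div_cancel_left₀ _ hC.ne'] at h4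
    linarith [neg_abs_le t]
  have hex_high : ∀ t, ∃ v ∈ Ioo a b, t ≤ S v := by
    intro t
    obtain ⟨h0, h1⟩ := hshrink t
    have h2 : (b - m) * Real.exp (-(C * |t|)) ≤ b - m :=
      mul_le_of_le_one_right (by linarith) h1
    have h3 : 0 < (b - m) * Real.exp (-(C * |t|)) := mul_pos (by linarith) h0
    have hv : b - (b - m) * Real.exp (-(C * |t|)) ∈ Ioo a b := ⟨by linarith, by linarith⟩
    refine ⟨_, hv, ?_⟩
    have h4 := hhigh hmI hv (by linarith)
    simp only [hSm, sub_sub_cancel] at h4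
    rw [Real.log_mul (by linarith) h0.ne', Real.log_exp, add_div, neg_div,
      mul_div_cancel_left₀ _ hC.ne'] at h4
    linarith [le_abs_self t]
  have hS'mono : StrictMono fun v : Ioo a b => S v := fun v w hvw => hmono v.2 w.2 hvw
  have hS'surj : Function.Surjective fun v : Ioo a b => S v := by
    intro t
    obtain ⟨v, hv, hvt⟩ := hex_low t
    obtain ⟨w, hw, hwt⟩ := hex_high t
    obtain ⟨x, hx, hxt⟩ := isPreconnected_Ioo.intermediate_value hv hw hSc ⟨hvt, hwt⟩
    exact ⟨⟨x, hx⟩, hxt⟩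
  set e := hS'mono.orderIsoOfSurjective _ hS'surj with he
  have hSe : ∀ t, S (e.symm t) = t := fun t => e.apply_symm_apply t
  have hec : Continuous fun t => (e.symm t : ℝ) := continuous_subtype_val.comp e.symm.continuous
  have hed : ∀ t, HasDerivAt (fun t => (e.symm t : ℝ)) (-W (e.symm t)) t := fun t => by
    have := (hSd _ (e.symm t).2).of_local_left_inverse (g := fun t => (e.symm t : ℝ))
      hec.continuousAt (inv_ne_zero (neg_pos.2 (hneg _ (e.symm t).2)).ne')
      (Eventually.of_forall hSe)
    simpa using this
  refine ⟨fun t => e.symm (-t), fun t => (e.symm (-t)).2, fun t => ?_, ?_, ?_⟩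
  · exact ((hed (-t)).comp t (hasDerivAt_neg t)).congr_deriv (by ring)
  · rw [tendsto_order]
    refine ⟨fun c hc => ?_, fun c hc => Eventually.of_forall fun t => (e.symm (-t)).2.2.trans hc⟩
    have hd : max c m ∈ Ioo a b := ⟨hmI.1.trans_le (le_max_right _ _), max_lt hc hmI.2⟩
    filter_upwards [eventually_lt_atBot (-S (max c m))] with t ht
    refine (le_max_left c m).trans_lt ?_
    have : (⟨max c m, hd⟩ : Ioo a b) < e.symm (-t) := by
      rw [OrderIso.lt_symm_apply]
      change S (max c m) < -t
      linarith
    exact this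
  · rw [tendsto_order]
    refine ⟨fun c hc => Eventually.of_forall fun t => hc.trans (e.symm (-t)).2.1, fun c hc => ?_⟩
    have hd : min c m ∈ Ioo a b := ⟨lt_min hc hmI.1, (min_le_right _ _).trans_lt hmI.2⟩
    filter_upwards [eventually_gt_atTop (-S (min c m))] with t ht
    refine lt_of_lt_of_le ?_ (min_le_left c m)
    have : e.symm (-t) < (⟨min c m, hd⟩ : Ioo a b) := by
      rw [OrderIso.symm_apply_lt]
      change -t < S (min c m)
      linarith
    exact this

theorem exists_lipschitz_bound_Icc {g : ℝ → ℝ} (hg : ContDiff ℝ 1 g) (a b : ℝ) :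
    ∃ K > 0, ∀ x ∈ Icc a b, ∀ y ∈ Icc a b, |g x - g y| ≤ K * |x - y| := by
  obtain ⟨K, hK⟩ := isCompact_Icc.exists_bound_of_continuousOn (s := Icc a b)
    (hg.continuous_deriv le_rfl).continuousOn
  refine ⟨max K 1, by positivity, fun x hx y hy => ?_⟩
  exact (convex_Icc a b).norm_image_sub_le_of_norm_deriv_le
    (fun t _ => hg.differentiable one_ne_zero t) (fun t ht => (hK t ht).trans (le_max_left _ _))
    hy hx

/-- A vector field with `(ε W² / 2)'(v) = v - φ(v)` and `W < 0` satisfies `W W' = (v - φ(v)) / ε`. -/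
theorem hasDerivAt_of_hasDerivAt_sq {W : ℝ → ℝ} {ε v y : ℝ} (hε : 0 < ε)
    (hneg : ∀ᶠ x in 𝓝 v, W x < 0)
    (h : HasDerivAt (fun x => ε * W x ^ 2 / 2) y v) : HasDerivAt W (y / (ε * W v)) v := by
  have hv : W v < 0 := hneg.self_of_nhds
  have h1 : HasDerivAt (fun x => W x ^ 2) (2 / ε * y) v := by
    refine (h.const_mul (2 / ε)).congr_of_eventuallyEq (Eventually.of_forall fun x => ?_)
    field_simp
  have h2 := (h1.sqrt (pow_ne_zero 2 hv.ne)).neg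
  rw [Real.sqrt_sq_eq_abs, abs_of_neg hv] at h2
  refine (h2.congr_of_eventuallyEq (hneg.mono fun x hx => ?_)).congr_deriv ?_
  · simp [Real.sqrt_sq_eq_abs, abs_of_neg hx]
  · have := hv.ne
    field_simp

/-- For small `ε` there is a profile whose `u`-component is continuous. -/
theorem exists_continuous_profile {f : ℝ → ℝ} (hf : ContDiff ℝ 2 f) {um up s : ℝ} (hlt : up < um)
    (hshock : IsAdmissibleShock f um up s) :
    ∃ εbar : ℝ, 0 < εbar ∧ ∀ ε : ℝ, 0 < ε → ε < εbar → ∃ u z : ℝ → ℝ,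
      IsAdmissibleProfile f um up s ε u z ∧ Tendsto u atBot (𝓝 um) ∧ Tendsto u atTop (𝓝 up) ∧
      Continuous u ∧ ContDiff ℝ 2 z := by
  set Φ := F f up s with hΦ
  have hΦ2 : ContDiff ℝ 2 Φ := contDiff_F hf up s
  have hΦd : ∀ x, HasDerivAt Φ (deriv Φ x) x := fun x =>
    (hΦ2.differentiable two_ne_zero x).hasDerivAt
  have hΦup : Φ up = 0 := by simp [hΦ, F]
  have hΦum : Φ um = 0 := (hshock.F_eq up).trans hΦup
  have hΦneg : ∀ v ∈ Ioo up um, Φ v < 0 := fun v hv => (hshock.F_lt up hv).trans_eq hΦum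
  have hg1 : ContDiff ℝ 1 fun x => Φ x * deriv Φ x :=
    (hΦ2.of_le one_le_two).mul
      ((contDiff_succ_iff_deriv (n := 1)).1 (by simpa [one_add_one_eq_two] using hΦ2)).2.2
  obtain ⟨K, hK0, hK⟩ := exists_lipschitz_bound_Icc hg1 up um
  obtain ⟨L, hL0, hL⟩ := exists_lipschitz_bound_Icc (hΦ2.of_le one_le_two) up um
  refine ⟨1 / (4 * K), by positivity, fun ε hε hεK => ?_⟩
  rw [lt_div_iff₀ (by positivity)] at hεK
  -- `ε F F'` on `[up, um]`, extended by its boundary values `0`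
  set p : ℝ → ℝ := fun x => projIcc up um hlt.le x with hp
  have hpI : ∀ x, p x ∈ Icc up um := fun x => (projIcc up um hlt.le x).2
  have hpeq : ∀ x ∈ Icc up um, p x = x := fun x hx => by
    simp [hp, projIcc_of_mem hlt.le hx]
  set γ : ℝ → ℝ := fun x => ε * (Φ (p x) * deriv Φ (p x)) with hγdef
  have hγ : ∀ x y, |γ x - γ y| ≤ 1 / 4 * |x - y| := by
    intro x y
    have h1 := hK _ (hpI x) _ (hpI y)
    have h2 : |p x - p y| ≤ |x - y| := abs_projIcc_sub_projIcc hlt.le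
    have h3 : γ x - γ y = ε * (Φ (p x) * deriv Φ (p x) - Φ (p y) * deriv Φ (p y)) := by
      simp only [hγdef]
      ring
    rw [h3, abs_mul, abs_of_pos hε]
    calc ε * |Φ (p x) * deriv Φ (p x) - Φ (p y) * deriv Φ (p y)|
        ≤ ε * (K * |x - y|) := by gcongr; exact h1.trans (by gcongr)
      _ = ε * K * |x - y| := by ring
      _ ≤ 1 / 4 * |x - y| := by gcongr; linarith
  obtain ⟨M, hM⟩ := isCompact_Icc.exists_bound_of_continuousOn (s := Icc up um)
    (hg1.continuous.const_mul ε).continuousOn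
  obtain ⟨φ, hφmono, hφlip, hφfix, hφder⟩ :=
    exists_slow_manifold (γ := γ) (fun x => hM _ (hpI x)) hγ
  have hφup : φ up = up := hφfix up (by simp [hγdef, hpeq up ⟨le_rfl, hlt.le⟩, hΦup])
  have hφum : φ um = um := hφfix um (by simp [hγdef, hpeq um ⟨hlt.le, le_rfl⟩, hΦum])
  have hφI : ∀ v ∈ Ioo up um, φ v ∈ Ioo up um := fun v hv =>
    ⟨hφup ▸ hφmono hv.1, hφum ▸ hφmono hv.2⟩
  have hφc : Continuous φ := (LipschitzWith.of_dist_le_mul (K := 2) (by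
      simpa [Real.dist_eq] using hφlip)).continuous
  have hWneg : ∀ v ∈ Ioo up um, Φ (φ v) < 0 := fun v hv => hΦneg _ (hφI v hv)
  have hWder : ∀ v ∈ Ioo up um,
      HasDerivAt (fun v => Φ (φ v)) ((v - φ v) / (ε * Φ (φ v))) v := by
    intro v hv
    have hΓ : HasDerivAt (fun x => ε * Φ x ^ 2 / 2) (γ (φ v)) (φ v) := by
      refine ((((hΦd (φ v)).pow 2).const_mul ε).div_const 2).congr_deriv ?_
      simp only [hγdef, hpeq _ (Ioo_subset_Icc_self (hφI v hv))]
      ring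
    refine hasDerivAt_of_hasDerivAt_sq (W := fun v => Φ (φ v)) hε ?_ (hφder _ v hΓ)
    filter_upwards [isOpen_Ioo.mem_nhds hv] with x hx using hWneg x hx
  have hWbd : ∀ v ∈ Ioo up um, ∀ c ∈ Icc up um, φ c = c → Φ c = 0 →
      -Φ (φ v) ≤ 2 * L * |v - c| := by
    intro v hv c hc hφ hΦc
    have h1 := hL _ (Ioo_subset_Icc_self (hφI v hv)) c hc
    have h2 := hφlip v c
    rw [hφ] at h2
    rw [hΦc, sub_zero, abs_of_neg (hWneg v hv)] at h1
    nlinarith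
  obtain ⟨z, hzI, hzd, hzbot, hztop⟩ := exists_connecting_orbit (W := fun v => Φ (φ v)) hlt
    (C := 2 * L) (by positivity) (hΦ2.continuous.comp hφc).continuousOn hWneg
    (fun v hv => (hWbd v hv up ⟨le_rfl, hlt.le⟩ hφup hΦup).trans_eq
      (by rw [abs_of_pos (sub_pos.2 hv.1)]))
    (fun v hv => (hWbd v hv um ⟨hlt.le, le_rfl⟩ hφum hΦum).trans_eq
      (by rw [abs_of_neg (sub_neg.2 hv.2), neg_sub]))
  have hz' : deriv z = fun t => Φ (φ (z t)) := funext fun t => (hzd t).deriv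
  have hzc : Continuous z := continuous_iff_continuousAt.2 fun t => (hzd t).continuousAt
  have hz'd : ∀ t, HasDerivAt (deriv z) ((z t - φ (z t)) / ε) t := fun t => by
    rw [hz']
    refine ((hWder _ (hzI t)).comp t (hzd t)).congr_deriv ?_
    have := (hWneg _ (hzI t)).ne
    field_simp
  have hz'' : deriv (deriv z) = fun t => (z t - φ (z t)) / ε := funext fun t => (hz'd t).deriv
  have hz2 : ContDiff ℝ 2 z := by
    rw [show (2 : WithTop ℕ∞) = 1 + 1 by norm_num, contDiff_succ_iff_deriv]
    refine ⟨fun t => (hzd t).differentiableAt, by simp, ?_⟩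
    rw [contDiff_one_iff_deriv]
    refine ⟨fun t => (hz'd t).differentiableAt, ?_⟩
    rw [hz'']
    fun_prop
  have huc : Continuous fun t => φ (z t) := hφc.comp hzc
  have hJ : ∀ t, t ∉ jumpSet fun t => φ (z t) := fun t ht => ht huc.continuousAt
  refine ⟨fun t => φ (z t), z, ?_, ?_, ?_, huc, hz2⟩
  · exact
      { contDiff := hz2.of_le one_le_two
        tendsto_atBot := hzbot
        tendsto_atTop := hztop
        locallyFinite := fun R => by
          rw [eq_empty_of_forall_notMem hJ, empty_inter]
          exact finite_empty
        differentiableAt_deriv := fun t _ => (hz'd t).differentiableAt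
        first_eq := fun t _ => by rw [hz']
        second_eq := fun t _ => by
          rw [hz'']
          field_simp
          ring
        jump := fun t ht => absurd ht (hJ t) }
  · simpa [Function.comp_def, hφum] using (hφc.tendsto um).comp hzbot
  · simpa [Function.comp_def, hφup] using (hφc.tendsto up).comp hztop

end RadiativeShock

theorem mainTheorem6 (f : ℝ → ℝ) (hf : ContDiff ℝ 2 f) (um up s : ℝ) (hlt : up < um)
    (hshock : RadiativeShock.IsAdmissibleShock f um up s) :
    ∃ εbar : ℝ, 0 < εbar ∧ ∀ ε : ℝ, 0 < ε → ε < εbar →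
      -- existence, with the regularity of both components
      (∃ u z : ℝ → ℝ,
        RadiativeShock.IsAdmissibleProfile f um up s ε u z ∧
        Tendsto u atBot (𝓝 um) ∧ Tendsto u atTop (𝓝 up) ∧
        (RadiativeShock.jumpSet u).Finite ∧
        ContDiffOn ℝ 2 z (RadiativeShock.jumpSet u)ᶜ ∧
        ∃ c : ℝ → ℝ, InjOn c (RadiativeShock.jumpSet u) ∧
          ∀ ξ ∈ RadiativeShock.jumpSet u,
            c ξ ∈ Ioo up um ∧ IsLocalMin (RadiativeShock.F f up s) (c ξ) ∧
            ∃ ul ur : ℝ, ur < c ξ ∧ c ξ < ul ∧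
              Tendsto u (𝓝[<] ξ) (𝓝 ul) ∧ Tendsto u (𝓝[>] ξ) (𝓝 ur) ∧
              Tendsto (deriv (deriv z)) (𝓝[<] ξ) (𝓝 ((z ξ - ul) / ε)) ∧
              Tendsto (deriv (deriv z)) (𝓝[>] ξ) (𝓝 ((z ξ - ur) / ε))) ∧
      -- uniqueness up to translation
      (∀ u₁ z₁ u₂ z₂ : ℝ → ℝ,
        RadiativeShock.IsAdmissibleProfile f um up s ε u₁ z₁ →
        RadiativeShock.IsAdmissibleProfile f um up s ε u₂ z₂ →
        ∃ h : ℝ, (∀ ξ, z₂ ξ = z₁ (ξ + h)) ∧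
          (∀ ξ, ξ ∈ RadiativeShock.jumpSet u₂ ↔ ξ + h ∈ RadiativeShock.jumpSet u₁) ∧
          (∀ ξ, ξ ∉ RadiativeShock.jumpSet u₂ → u₂ ξ = u₁ (ξ + h))) := by
  obtain ⟨εbar, hpos, hex⟩ := RadiativeShock.exists_continuous_profile hf hlt hshock
  refine ⟨εbar, hpos, fun ε hε hεb => ⟨?_, fun u₁ z₁ u₂ z₂ h₁ h₂ =>
    RadiativeShock.IsAdmissibleProfile.eq_shift hf hlt hε h₁ h₂⟩⟩
  obtain ⟨u, z, hprof, hbot, htop, hu, hz⟩ := hex ε hε hεb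
  have hJ : RadiativeShock.jumpSet u = ∅ :=
    eq_empty_of_forall_notMem fun ξ hξ => hξ hu.continuousAt
  refine ⟨u, z, hprof, hbot, htop, hJ ▸ finite_empty, hz.contDiffOn, id, injOn_id _, ?_⟩
  rw [hJ]
  exact fun ξ hξ => absurd hξ (notMem_empty ξ)
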